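/- Fix $d\ge 1$, $\beta>0$, $L_H\ge 0$, $B\ge 0$, $L\ge 1$, $\sigma_p>0$, $\mu_0>0$ and $p\in(1,2]$. In round $t=1,2,\dots,T$ a context $x_t\in[0,1]^d$ is revealed, a broker posts a price $P_t$, and then observes the valuations $V_t=m(x_t)+\xi_t$ and $W_t=m(x_t)+\zeta_t$. The gain from trade is $g(\pi,v,w)=(v\vee w-v\wedge w)\,\mathbb 1\{v\wedge w\le \pi\le v\vee w\}$ and the regret is $R_T=\sum_{t=1}^T\mathbb E[g(m(x_t),V_t,W_t)-g(P_t,V_t,W_t)]$. Assume: (i) $|m(x)-m(x')|\le L_H\|x-x'\|^\beta$ for all $x,x'\in[0,1]^d$, and $\sup_{[0,1]^d}|m|\le B$ (such a $B$ always exists; the algorithm uses it); (ii) the $x_t$ are i.i.d. with a density on $[0,1]^d$ that is at least $\mu_0$ there; (iii) all $\xi_t,\zeta_t$ have mean zero, a density bounded by $L$, and $\mathbb E|\xi_t|^p,\ \mathbb E|\zeta_t|^p\le\sigma_p^p$ (their laws may depend on $t$); (iv) all the variables $x_t,\xi_t,\zeta_t$, $t\ge1$, are independent. The epoch-partition algorithm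 with horizon $T$ is as follows. Let $h=T^{-(p-1)/(\beta p+d(p-1))}$ and $M=\lceil h^{-1}\rceil^d$, and tile $[0,1]^d$ by $M$ axis-aligned cells of side $h$ (those at the boundary are cut off by the cube). Epoch $k\ge1$ consists of the rounds $2^{k-1}\le t<2^k$. In epoch $1$ an arbitrary fixed price $\pi_0$ is posted. In round $t$ of epoch $k\ge 2$ with $x_t$ in the cell $C$, let $S$ be the set of rounds $s$ of epoch $k-1$ with $x_s\in C$, and let $Y_s=(V_s+W_s)/2$; post $P_t=\pi_0$ if $S=\emptyset$, and otherwise the truncated mean $$P_t=\frac1{|S|}\sum_{s\in S}Y_s\,\mathbb 1\{|Y_s|\le\tau\},\qquad \tau=\Bigl(\frac{(B+\sigma_p)^p\,|S|}{\log(MT)}\Bigr)^{1/p}.$$ Then there are constants $C$ and $\kappa$, depending only on $d,\beta,L_H,B,L,\sigma_p,\mu_0,p$, such that for all $T\ge2$, all $\pi_0\in\mathbb R$ and all environments satisfying (i)–(iv), the expectations defining $R_T$ exist (the random variables in them are integrable), and this algorithm has $$R_T\le C\,(\log T)^\kappa\,T^{\,1-2\beta(p-1)/(\beta p+d(p-1))}.$$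 For $p=2$ the exponent equals $d/(2\beta+d)$, and as $p\to1^+$ the exponent tends to $1$. -/

import Mathlib

open MeasureTheory ProbabilityTheory Filter Topology
open scoped ENNReal

namespace BilateralTrade

noncomputable section

/-- The context space `ℝ^d` with its Euclidean norm. -/
abbrev Ctx (d : ℕ) : Type := EuclideanSpace ℝ (Fin d)

/-- The unit cube `[0,1]^d`. -/
def unitCube (d : ℕ) : Set (Ctx d) := {z | ∀ i, 0 ≤ z i ∧ z i ≤ 1}

/-- The gain from trade `g(π, v, w) = (v ∨ w - v ∧ w) 1{v ∧ w ≤ π ≤ v ∨ w}`. -/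
def gain (π v w : ℝ) : ℝ :=
  if min v w ≤ π ∧ π ≤ max v w then max v w - min v w else 0

/-! ### The stochastic environment -/

/-- `X` has a density with respect to Lebesgue measure which is bounded by `L`. -/
def HasDensityBoundedBy {Ω : Type*} [MeasurableSpace Ω] (P : Measure Ω) (X : Ω → ℝ) (L : ℝ) :
    Prop :=
  ∃ f : ℝ → ℝ≥0∞, Measurable f ∧ (∀ s, f s ≤ ENNReal.ofReal L) ∧
    P.map X = (volume : Measure ℝ).withDensity f

/-- A noise variable: zero mean, a density bounded by `L`, and `E|X|^p ≤ σ^p`. -/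
structure IsNoise {Ω : Type*} [MeasurableSpace Ω] (P : Measure Ω) (L p σ : ℝ) (X : Ω → ℝ) :
    Prop where
  measurable : Measurable X
  density : HasDensityBoundedBy P X L
  integrable_rpow : Integrable (fun ω => |X ω| ^ p) P
  moment : ∫ ω, |X ω| ^ p ∂P ≤ σ ^ p
  integrable : Integrable X P
  mean_zero : ∫ ω, X ω ∂P = 0

/-- `m` is `(β, H)`-Hölder on the unit cube. -/
def HolderOnCube {d : ℕ} (β H : ℝ) (m : Ctx d → ℝ) : Prop :=
  ∀ z ∈ unitCube d, ∀ z' ∈ unitCube d, |m z - m z'| ≤ H * ‖z - z'‖ ^ β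

/-- The contexts are identically distributed on the unit cube, and their common law has a density
which is at least `μ₀` there. -/
structure IsContextProcess {Ω : Type*} [MeasurableSpace Ω] (P : Measure Ω) {d : ℕ} (μ₀ : ℝ)
    (x : ℕ → Ω → Ctx d) : Prop where
  measurable : ∀ t, Measurable (x t)
  mem_cube : ∀ t ω, x t ω ∈ unitCube d
  density : ∃ q : Ctx d → ℝ≥0∞, Measurable q ∧ (∀ z ∈ unitCube d, ENNReal.ofReal μ₀ ≤ q z) ∧
    ∀ t, P.map (x t) = ((volume : Measure (Ctx d)).restrict (unitCube d)).withDensity q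

/-- An environment: the market value `m`, contexts `x t`, and noises `ξ t`, `ζ t`.  All the random
variables are independent, within each round and across rounds.  The noise laws may depend on the
round. -/
structure IsEnvironment {Ω : Type*} [MeasurableSpace Ω] (P : Measure Ω) {d : ℕ}
    (β H B L p σ μ₀ : ℝ) (m : Ctx d → ℝ) (x : ℕ → Ω → Ctx d) (ξ ζ : ℕ → Ω → ℝ) : Prop where
  holder : HolderOnCube β H m
  bounded : ∀ z ∈ unitCube d, |m z| ≤ B
  contexts : IsContextProcess P μ₀ x
  noise_xi : ∀ t, IsNoise P L p σ (ξ t)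
  noise_zeta : ∀ t, IsNoise P L p σ (ζ t)
  indep_rounds : iIndepFun (fun t ω => (x t ω, ξ t ω, ζ t ω)) P
  indep_context_noise : ∀ t, IndepFun (x t) (fun ω => (ξ t ω, ζ t ω)) P
  indep_noise : ∀ t, IndepFun (ξ t) (ζ t) P

/-- The valuation `m(x_t) + (noise)_t` of a trader in round `t`. -/
def valuation {Ω : Type*} {d : ℕ} (m : Ctx d → ℝ) (x : ℕ → Ω → Ctx d) (noise : ℕ → Ω → ℝ)
    (t : ℕ) (ω : Ω) : ℝ :=
  m (x t ω) + noise t ω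

/-! ### The epoch-partition algorithm -/

/-- The side length `h = T^{-(p-1)/(βp + d(p-1))}` of the cells. -/
def sideLength (d : ℕ) (β p : ℝ) (T : ℕ) : ℝ :=
  (T : ℝ) ^ (-((p - 1) / (β * p + d * (p - 1))))

/-- The number `⌈1/h⌉` of cells along each axis. -/
def cellsPerAxis (h : ℝ) : ℕ := ⌈h⁻¹⌉₊

/-- The total number `M = ⌈1/h⌉^d` of cells. -/
def numCells (d : ℕ) (h : ℝ) : ℕ := cellsPerAxis h ^ d

/-- The cell of side `h` that contains the context `z`.  Cell `j` is `∏ i, [j i * h, (j i + 1) * h)`;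
the minimum only puts the face `z i = 1` into the last cell when `1/h` is an integer. -/
def cellIndex {d : ℕ} (h : ℝ) (z : Ctx d) : Fin d → ℕ :=
  fun i => min ⌊z i / h⌋₊ (cellsPerAxis h - 1)

/-- The epoch `k` of round `t ≥ 1`, i.e. the `k` with `2^(k-1) ≤ t < 2^k`. -/
def epoch (t : ℕ) : ℕ := Nat.log 2 t + 1

/-- The rounds `2^(k-1), …, 2^k - 1` of epoch `k`. -/
def epochRounds (k : ℕ) : Finset ℕ := Finset.Ico (2 ^ (k - 1)) (2 ^ k)

/-- The truncated mean of the observations `Y s`, `s ∈ S`, with raw-moment bound `u` and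
confidence parameter `l`: the truncation level is `(u * |S| / l)^(1/p)`. -/
def truncatedMean (p u l : ℝ) (S : Finset ℕ) (Y : ℕ → ℝ) : ℝ :=
  (∑ s ∈ S, if |Y s| ≤ (u * (S.card : ℝ) / l) ^ (1 / p) then Y s else 0) / (S.card : ℝ)

/-- The rounds of the epoch preceding that of `t` whose context lies in the cell of the context of
round `t`. -/
def cellSample {d : ℕ} (h : ℝ) (x : ℕ → Ctx d) (t : ℕ) : Finset ℕ :=
  (epochRounds (epoch t - 1)).filter (fun s => cellIndex h (x s) = cellIndex h (x t))

/-- The price posted in round `t` with horizon `T`, when the contexts are `x` and the valuations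
`v`, `w`.  In epoch 1 the price is the fixed price `π₀`, and so it is in a cell without any
observation; otherwise it is the truncated mean of `Y s = (v s + w s) / 2` over the rounds `s` of
the previous epoch with context in the same cell, with moment bound `u = (B + σ)^p` and confidence
parameter `log (M T)`.  The price depends on the current context and on data of earlier rounds. -/
def price {d : ℕ} (β B p σ π₀ : ℝ) (T : ℕ) (x : ℕ → Ctx d) (v w : ℕ → ℝ) (t : ℕ) : ℝ :=
  let h := sideLength d β p T
  let S := cellSample h x t
  if epoch t ≤ 1 ∨ S = ∅ then π₀
  else truncatedMean p ((B + σ) ^ p) (Real.log ((numCells d h : ℝ) * (T : ℝ))) S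
    (fun s => (v s + w s) / 2)

/-! ### Regret -/

/-- The random regret `g(m(x_t), V_t, W_t) - g(P_t, V_t, W_t)` of the algorithm in round `t`. -/
def roundRegret {Ω : Type*} {d : ℕ} (β B p σ π₀ : ℝ) (T : ℕ) (m : Ctx d → ℝ)
    (x : ℕ → Ω → Ctx d) (ξ ζ : ℕ → Ω → ℝ) (t : ℕ) (ω : Ω) : ℝ :=
  let V := fun s => valuation m x ξ s ω
  let W := fun s => valuation m x ζ s ω
  gain (m (x t ω)) (V t) (W t)
    - gain (price β B p σ π₀ T (fun s => x s ω) V W t) (V t) (W t)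

/-- The regret `R_T = ∑_{t=1}^T E[g(m(x_t), V_t, W_t) - g(P_t, V_t, W_t)]`. -/
def regret {Ω : Type*} [MeasurableSpace Ω] (P : Measure Ω) {d : ℕ} (β B p σ π₀ : ℝ) (T : ℕ)
    (m : Ctx d → ℝ) (x : ℕ → Ω → Ctx d) (ξ ζ : ℕ → Ω → ℝ) : ℝ :=
  ∑ t ∈ Finset.Icc 1 T, ∫ ω, roundRegret β B p σ π₀ T m x ξ ζ t ω ∂P

/-- The exponent `1 - 2β(p-1)/(βp + d(p-1))`. -/
def rateExponent (d : ℕ) (β p : ℝ) : ℝ :=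
  1 - 2 * β * (p - 1) / (β * p + d * (p - 1))

end

end BilateralTrade

/-!
The regret of a price `π` is quadratic in its distance to the market value. With independent centred
noises `ξ`, `ζ` that have no atoms, the expected gain at price `m + δ` is
`E[ξ 1{ξ > δ}] + E[ζ 1{ζ > δ}]`: almost surely a trade takes place iff exactly one of the noises
exceeds `δ`, and the mixed terms `E[ξ 1{ζ > δ}] = E[ξ] P(ζ > δ)` vanish (`integral_gain`). Since the
densities are at most `L`, moving from `δ = 0` to another `δ` costs at most `2 L δ²`
(`integral_gain_sub_gain_le`). It therefore suffices to bound the mean squared error of the posted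
price, and no high-probability statement about the truncated mean is needed.

The contexts are independent of the noises as processes, so the regret of a round may be bounded first
for a fixed sequence of contexts (`integral_le_of_indepFun`). There the price is the mean of `n`
truncated independent observations, and is independent of the current noises. Its bias has a
Hölder part of order `h ^ β` and a truncation part, and at the truncation level `(u n / l) ^ (1 / p)`
the squared truncation bias and the variance are both of order `n ^ (-a)`, up to logarithms, where
`a = 2 - 2 / p ∈ (0, 1]` (`integral_sq_truncatedMean_sub_le`). A cell without observations costs at
most `E|ξ - ζ|`, which is also covered by a multiple of `(n + 1) ^ (-a)`.

It remains to average `(n + 1) ^ (-a)` over the contexts. If `N` is the length of the previous epoch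
and `M` the number of cells, exchangeability of the contexts gives `E[1 / (n + 1)] ≤ M / (N + 1)`: the
reciprocals `1 / (n + 1)`, taken at each of the `N + 1` rounds in turn, add up to the number of occupied
cells (`integral_inv_card_le`). This is why small boundary cells do no harm, whatever the law of the
contexts. As `a ≤ 1`, it follows that `E[(n + 1) ^ (-a)]` is at most a multiple of `(M / t) ^ a`, and
summation over `t ≤ T` with `M` of order `h ^ (-d)` yields `T h ^ (2 β) + h ^ (-d a) T ^ (1 - a)` up to
logarithms. The chosen `h` makes both terms equal to `T` to the power `rateExponent d β p`.
-/

namespace BilateralTrade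

noncomputable section

/-! ### Independence of processes and integration over one of two independent variables -/

section Independence

variable {Ω : Type*} [MeasurableSpace Ω] {P : Measure Ω} [IsProbabilityMeasure P]

/-- If the pairs `(X i, Y i)` are independent of one another, and `X i` is independent of `Y i` for
each `i`, then the whole process `X` is independent of the whole process `Y`. -/
lemma indepFun_process_of_iIndepFun_prodMk {ι E F : Type*} [MeasurableSpace E] [MeasurableSpace F]
    {X : ι → Ω → E} {Y : ι → Ω → F} (hX : ∀ i, Measurable (X i)) (hY : ∀ i, Measurable (Y i))
    (h : iIndepFun (fun i ω => (X i ω, Y i ω)) P) (hXY : ∀ i, IndepFun (X i) (Y i) P) :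
    IndepFun (fun ω i => X i ω) (fun ω i => Y i ω) P := by
  classical
  refine IndepFun.process_indepFun_process hX hY fun I J => ?_
  have key : IndepFun (fun ω (i : (I ∪ J : Finset ι)) => X i ω)
      (fun ω (i : (I ∪ J : Finset ι)) => Y i ω) P := by
    set K := I ∪ J
    have h1 : iIndepFun (fun (i : K) ω => (X i ω, Y i ω)) P :=
      h.precomp (g := ((↑) : K → ι)) Subtype.val_injective
    have hm : ∀ i : K, AEMeasurable (fun ω => (X i ω, Y i ω)) P :=
      fun i => ((hX i).prodMk (hY i)).aemeasurable
    rw [iIndepFun_iff_map_fun_eq_pi_map hm] at h1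
    have hXm : ∀ i : K, IsProbabilityMeasure (P.map (X i)) :=
      fun i => Measure.isProbabilityMeasure_map (hX i).aemeasurable
    have hYm : ∀ i : K, IsProbabilityMeasure (P.map (Y i)) :=
      fun i => Measure.isProbabilityMeasure_map (hY i).aemeasurable
    have h2 : ∀ i : K, P.map (fun ω => (X i ω, Y i ω)) = (P.map (X i)).prod (P.map (Y i)) :=
      fun i => (indepFun_iff_map_prod_eq_prod_map_map (hX i).aemeasurable
        (hY i).aemeasurable).1 (hXY i)
    simp_rw [h2] at h1
    have h3 := (measurePreserving_arrowProdEquivProdArrow E F K (fun i => P.map (X i))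
      (fun i => P.map (Y i))).map_eq
    have hX1 : iIndepFun (fun (i : K) ω => X i ω) P :=
      (h.precomp (g := ((↑) : K → ι)) Subtype.val_injective).comp (fun _ => Prod.fst)
        fun _ => measurable_fst
    have hY1 : iIndepFun (fun (i : K) ω => Y i ω) P :=
      (h.precomp (g := ((↑) : K → ι)) Subtype.val_injective).comp (fun _ => Prod.snd)
        fun _ => measurable_snd
    rw [indepFun_iff_map_prod_eq_prod_map_map (by fun_prop) (by fun_prop),
      hX1.map_fun_eq_pi_map (f := fun i : K => X i) (fun i => (hX i).aemeasurable),
      hY1.map_fun_eq_pi_map (f := fun i : K => Y i) (fun i => (hY i).aemeasurable), ← h3, ← h1,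
      Measure.map_map (MeasurableEquiv.measurable _) (by fun_prop)]
    rfl
  exact key.comp
    (φ := fun (z : (I ∪ J : Finset ι) → E) (i : I) => z ⟨i, Finset.mem_union_left _ i.2⟩)
    (ψ := fun (z : (I ∪ J : Finset ι) → F) (j : J) => z ⟨j, Finset.mem_union_right _ j.2⟩)
    (by fun_prop) (by fun_prop)

/-- To bound `E[f(X, Y)]` for independent `X`, `Y`, it suffices to bound `E[f(z, Y)]` for each fixed
value `z` taken by `X`. -/
lemma integral_le_of_indepFun {E F : Type*} [MeasurableSpace E] [MeasurableSpace F]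
    {X : Ω → E} {Y : Ω → F} (hX : Measurable X) (hY : Measurable Y) (hXY : IndepFun X Y P)
    {f : E → F → ℝ} (hf : Measurable (Function.uncurry f))
    (hint : Integrable (fun ω => f (X ω) (Y ω)) P) {b : E → ℝ}
    (hb : Integrable (fun ω => b (X ω)) P) (h : ∀ ω', ∫ ω, f (X ω') (Y ω) ∂P ≤ b (X ω')) :
    ∫ ω, f (X ω) (Y ω) ∂P ≤ ∫ ω, b (X ω) ∂P := by
  have hlaw : P.map (fun ω => (X ω, Y ω)) = (P.prod P).map (Prod.map X Y) := by
    rw [(indepFun_iff_map_prod_eq_prod_map_map hX.aemeasurable hY.aemeasurable).1 hXY,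
      Measure.map_prod_map _ _ hX hY]
  have e1 : ∫ ω, f (X ω) (Y ω) ∂P = ∫ q, f (X q.1) (Y q.2) ∂(P.prod P) := by
    have h1 := integral_map (μ := P) (hX.prodMk hY).aemeasurable (f := Function.uncurry f)
      hf.aestronglyMeasurable
    have h2 := integral_map (μ := P.prod P) (hX.prodMap hY).aemeasurable (f := Function.uncurry f)
      hf.aestronglyMeasurable
    rw [hlaw, h2] at h1
    exact h1.symm
  have i2 : Integrable (fun q : Ω × Ω => f (X q.1) (Y q.2)) (P.prod P) := by
    have h1 := integrable_map_measure (μ := P) (g := Function.uncurry f)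
      hf.aestronglyMeasurable (hX.prodMk hY).aemeasurable
    have h2 := integrable_map_measure (μ := P.prod P) (g := Function.uncurry f)
      hf.aestronglyMeasurable (hX.prodMap hY).aemeasurable
    rw [hlaw] at h1
    exact h2.1 (h1.2 hint)
  rw [e1, integral_prod _ i2]
  exact integral_mono i2.integral_prod_left hb h

end Independence

/-! ### The expected gain as a function of the price -/

section Gain

lemma gain_nonneg (π v w : ℝ) : 0 ≤ gain π v w := by
  unfold gain
  split_ifs
  · exact sub_nonneg.2 min_le_max
  · exact le_rfl

lemma gain_le_abs_sub (π v w : ℝ) : gain π v w ≤ |v - w| := by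
  unfold gain
  split_ifs
  · rw [max_sub_min_eq_abs']
  · exact abs_nonneg _

lemma gain_add_left (c π v w : ℝ) : gain π (c + v) (c + w) = gain (π - c) v w := by
  unfold gain
  rw [min_add_add_left, max_add_add_left]
  congr 1
  · rw [le_sub_iff_add_le', sub_le_iff_le_add']
  · ring

lemma abs_gain_sub_gain_le (π π' v w : ℝ) : |gain π v w - gain π' v w| ≤ |v - w| := by
  rw [abs_le]
  constructor <;> linarith [gain_nonneg π v w, gain_nonneg π' v w, gain_le_abs_sub π v w,
    gain_le_abs_sub π' v w]

lemma measurable_gain : Measurable (fun q : ℝ × ℝ × ℝ => gain q.1 q.2.1 q.2.2) := by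
  unfold gain
  have h1 : MeasurableSet {q : ℝ × ℝ × ℝ | min q.2.1 q.2.2 ≤ q.1} :=
    measurableSet_le (by fun_prop) (by fun_prop)
  have h2 : MeasurableSet {q : ℝ × ℝ × ℝ | q.1 ≤ max q.2.1 q.2.2} :=
    measurableSet_le (by fun_prop) (by fun_prop)
  exact Measurable.ite (h1.inter h2) (by fun_prop) (by fun_prop)

/-- Off the ties `v = π`, `w = π` a trade takes place iff exactly one valuation exceeds the price,
which makes the gain `(v - w)(1{π < v} - 1{π < w})`. -/
lemma gain_eq_of_ne {π v w : ℝ} (hv : v ≠ π) (hw : w ≠ π) :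
    gain π v w = v * (if π < v then 1 else 0) + w * (if π < w then 1 else 0)
      - v * (if π < w then 1 else 0) - w * (if π < v then 1 else 0) := by
  unfold gain
  rcases lt_or_gt_of_ne hv with h1 | h1 <;> rcases lt_or_gt_of_ne hw with h2 | h2
  · simp [h1.not_gt, h2.not_gt, h1.not_ge, h2.not_ge]
  · simp [h1.not_gt, h2, h1.le, h2.le, min_eq_left (h1.trans h2).le, max_eq_right (h1.trans h2).le]
  · simp [h2.not_gt, h1, h1.le, h2.le, min_eq_right (h2.trans h1).le, max_eq_left (h2.trans h1).le]
  · simp [h1, h2, h1.not_ge, h2.not_ge]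

variable {Ω : Type*} [MeasurableSpace Ω] {P : Measure Ω}

lemma HasDensityBoundedBy.measure_preimage_le {X : Ω → ℝ} {L : ℝ}
    (h : HasDensityBoundedBy P X L) (hX : Measurable X) {A : Set ℝ} (hA : MeasurableSet A) :
    P (X ⁻¹' A) ≤ ENNReal.ofReal L * volume A := by
  obtain ⟨f, -, hfL, hf⟩ := h
  rw [← Measure.map_apply hX hA, hf, withDensity_apply _ hA, ← setLIntegral_const]
  exact lintegral_mono fun s => hfL s

lemma HasDensityBoundedBy.ae_ne {X : Ω → ℝ} {L : ℝ} (h : HasDensityBoundedBy P X L)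
    (hX : Measurable X) (a : ℝ) : ∀ᵐ ω ∂P, X ω ≠ a := by
  have := h.measure_preimage_le hX (measurableSet_singleton a)
  rw [Real.volume_singleton, mul_zero, nonpos_iff_eq_zero] at this
  rw [ae_iff]
  simpa [Set.preimage] using this

lemma integrable_mul_ite {X Y : Ω → ℝ} (hX : Measurable X) (hXi : Integrable X P)
    (hY : Measurable Y) (π : ℝ) :
    Integrable (fun ω => X ω * (if π < Y ω then 1 else 0)) P := by
  refine hXi.mono (hX.mul ?_).aestronglyMeasurable (ae_of_all _ fun ω => ?_)
  · exact Measurable.ite (measurableSet_lt measurable_const hY) measurable_const measurable_const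
  · rw [norm_mul]
    split_ifs <;> simp

/-- For independent centred valuations the mixed terms of `gain_eq_of_ne` vanish in expectation. -/
lemma integral_gain {X Y : Ω → ℝ} {L p σ : ℝ} (hX : IsNoise P L p σ X) (hY : IsNoise P L p σ Y)
    (hXY : IndepFun X Y P) (π : ℝ) :
    ∫ ω, gain π (X ω) (Y ω) ∂P
      = ∫ ω, X ω * (if π < X ω then 1 else 0) ∂P + ∫ ω, Y ω * (if π < Y ω then 1 else 0) ∂P := by
  have hJ : Measurable fun y : ℝ => if π < y then (1 : ℝ) else 0 :=
    Measurable.ite measurableSet_Ioi measurable_const measurable_const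
  have cross : ∀ {U V : Ω → ℝ}, IsNoise P L p σ U → IsNoise P L p σ V → IndepFun U V P →
      ∫ ω, U ω * (if π < V ω then 1 else 0) ∂P = 0 := by
    intro U V hU hV hUV
    have := hUV.integral_fun_comp_mul_comp (f := id) (g := fun y : ℝ => if π < y then (1 : ℝ) else 0)
      hU.measurable.aemeasurable hV.measurable.aemeasurable aestronglyMeasurable_id
      hJ.aestronglyMeasurable
    simpa [hU.mean_zero] using this
  have iXX := integrable_mul_ite hX.measurable hX.integrable hX.measurable π
  have iXY := integrable_mul_ite hX.measurable hX.integrable hY.measurable π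
  have iYX := integrable_mul_ite hY.measurable hY.integrable hX.measurable π
  have iYY := integrable_mul_ite hY.measurable hY.integrable hY.measurable π
  have hae : (fun ω => gain π (X ω) (Y ω)) =ᵐ[P] fun ω =>
      X ω * (if π < X ω then 1 else 0) + Y ω * (if π < Y ω then 1 else 0)
        - X ω * (if π < Y ω then 1 else 0) - Y ω * (if π < X ω then 1 else 0) := by
    filter_upwards [hX.density.ae_ne hX.measurable π, hY.density.ae_ne hY.measurable π] with ω h1 h2
    exact gain_eq_of_ne h1 h2
  have i1 : Integrable (fun ω => X ω * (if π < X ω then 1 else 0)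
      + Y ω * (if π < Y ω then 1 else 0)) P := iXX.add iYY
  have i2 : Integrable (fun ω => X ω * (if π < X ω then 1 else 0)
      + Y ω * (if π < Y ω then 1 else 0) - X ω * (if π < Y ω then 1 else 0)) P := i1.sub iXY
  rw [integral_congr_ae hae, integral_sub i2 iYX, integral_sub i1 iXY, integral_add iXX iYY, cross hX hY hXY, cross hY hX hXY.symm]
  ring

variable [IsProbabilityMeasure P]

/-- Summed over both valuations, this is the expected loss from the offset `δ`. -/
lemma integral_mul_ite_sub_le {X : Ω → ℝ} {L p σ : ℝ} (hL : 0 ≤ L) (hX : IsNoise P L p σ X)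
    (δ : ℝ) :
    ∫ ω, X ω * (if 0 < X ω then 1 else 0) ∂P - ∫ ω, X ω * (if δ < X ω then 1 else 0) ∂P
      ≤ L * δ ^ 2 := by
  rw [← integral_sub (integrable_mul_ite hX.measurable hX.integrable hX.measurable 0)
    (integrable_mul_ite hX.measurable hX.integrable hX.measurable δ)]
  have hA : MeasurableSet (X ⁻¹' Set.uIcc 0 δ) := hX.measurable measurableSet_uIcc
  -- The integrand lives on `{X ∈ [0 ∧ δ, 0 ∨ δ]}`, where it is at most `|δ|`.
  have hle : ∀ ω, X ω * (if 0 < X ω then 1 else 0) - X ω * (if δ < X ω then 1 else 0)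
      ≤ (X ⁻¹' Set.uIcc 0 δ).indicator (fun _ => |δ|) ω := by
    intro ω
    by_cases hω : ω ∈ X ⁻¹' Set.uIcc 0 δ
    · rw [Set.indicator_of_mem hω]
      rcases Set.mem_uIcc.1 hω with ⟨h1, h2⟩ | ⟨h1, h2⟩
      · rw [abs_of_nonneg (h1.trans h2)]
        split_ifs <;> linarith
      · rw [abs_of_nonpos (h1.trans h2)]
        split_ifs <;> linarith
    · rw [Set.indicator_of_notMem hω]
      have hn : ¬((0 ≤ X ω ∧ X ω ≤ δ) ∨ (δ ≤ X ω ∧ X ω ≤ 0)) := fun h => hω (Set.mem_uIcc.2 h)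
      push Not at hn
      obtain ⟨h1, h2⟩ := hn
      rcases lt_or_ge 0 (X ω) with h | h
      · rw [if_pos h, if_pos (h1 h.le)]; simp
      · rw [if_neg h.not_gt]
        split_ifs with h3
        · have := h2 h3.le
          linarith
        · simp
  refine (integral_mono ((integrable_mul_ite hX.measurable hX.integrable hX.measurable 0).sub
    (integrable_mul_ite hX.measurable hX.integrable hX.measurable δ))
    ((integrable_const |δ|).indicator hA) hle).trans ?_
  rw [integral_indicator_const _ hA, smul_eq_mul]
  have hm : P.real (X ⁻¹' Set.uIcc 0 δ) ≤ L * |δ| := by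
    have := hX.density.measure_preimage_le hX.measurable (A := Set.uIcc 0 δ) measurableSet_uIcc
    rw [Real.volume_interval, sub_zero, ← ENNReal.ofReal_mul hL] at this
    exact ENNReal.toReal_le_of_le_ofReal (by positivity) this
  calc P.real (X ⁻¹' Set.uIcc 0 δ) * |δ| ≤ L * |δ| * |δ| := by gcongr
    _ = L * δ ^ 2 := by rw [mul_assoc, abs_mul_abs_self, sq]

/-- Missing the market value `c` by `π - c` costs only a multiple of `(π - c)²`. -/
lemma integral_gain_sub_gain_le {X Y : Ω → ℝ} {L p σ : ℝ} (hL : 0 ≤ L) (hX : IsNoise P L p σ X)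
    (hY : IsNoise P L p σ Y) (hXY : IndepFun X Y P) (c π : ℝ) :
    ∫ ω, (gain c (c + X ω) (c + Y ω) - gain π (c + X ω) (c + Y ω)) ∂P ≤ 2 * L * (π - c) ^ 2 := by
  have hi : ∀ δ, Integrable (fun ω => gain δ (X ω) (Y ω)) P := by
    intro δ
    refine (hX.integrable.sub hY.integrable).mono ?_ (ae_of_all _ fun ω => ?_)
    · exact (measurable_gain.comp
        (measurable_const.prodMk (hX.measurable.prodMk hY.measurable))).aestronglyMeasurable
    · rw [Real.norm_eq_abs, abs_of_nonneg (gain_nonneg _ _ _)]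
      exact gain_le_abs_sub _ _ _
  simp_rw [gain_add_left, sub_self]
  rw [integral_sub (hi 0) (hi _), integral_gain hX hY hXY, integral_gain hX hY hXY]
  have h1 := integral_mul_ite_sub_le hL hX (π - c)
  have h2 := integral_mul_ite_sub_le hL hY (π - c)
  linarith

end Gain

/-! ### Truncated means of heavy-tailed observations -/

section Truncation

/-- The value `y` if `|y| ≤ τ`, and `0` otherwise. -/
def trunc (τ y : ℝ) : ℝ := if |y| ≤ τ then y else 0

lemma measurable_trunc : Measurable (fun q : ℝ × ℝ => trunc q.1 q.2) := by
  unfold trunc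
  exact Measurable.ite (measurableSet_le (by fun_prop) (by fun_prop)) (by fun_prop) (by fun_prop)

lemma abs_trunc_le {τ : ℝ} (hτ : 0 ≤ τ) (y : ℝ) : |trunc τ y| ≤ τ := by
  unfold trunc
  split_ifs with h
  · exact h
  · simpa using hτ

lemma trunc_sq_le {τ p : ℝ} (hp : p ≤ 2) (hp0 : 0 < p) (hτ : 0 < τ) (y : ℝ) :
    trunc τ y ^ 2 ≤ τ ^ (2 - p) * |y| ^ p := by
  unfold trunc
  split_ifs with h
  · calc y ^ 2 = |y| ^ ((2 - p) + p) := by rw [sub_add_cancel, Real.rpow_two, sq_abs]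
      _ = |y| ^ (2 - p) * |y| ^ p :=
          Real.rpow_add_of_nonneg (abs_nonneg _) (by linarith) hp0.le
      _ ≤ τ ^ (2 - p) * |y| ^ p := by
          gcongr
  · rw [zero_pow two_ne_zero]
    positivity

lemma abs_sub_trunc_le {τ p : ℝ} (hp : 1 ≤ p) (hτ : 0 < τ) (y : ℝ) :
    |y - trunc τ y| ≤ τ ^ (1 - p) * |y| ^ p := by
  unfold trunc
  split_ifs with h
  · rw [sub_self, abs_zero]
    positivity
  · have hy : 0 < |y| := hτ.trans (not_le.1 h)
    calc |y - 0| = |y| ^ ((1 - p) + p) := by rw [sub_add_cancel, Real.rpow_one, sub_zero]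
      _ = |y| ^ (1 - p) * |y| ^ p := Real.rpow_add hy _ _
      _ ≤ τ ^ (1 - p) * |y| ^ p := by
          gcongr ?_ * _
          exact Real.rpow_le_rpow_of_nonpos hτ (not_le.1 h).le (by linarith)

variable {Ω : Type*} [MeasurableSpace Ω] {P : Measure Ω} [IsProbabilityMeasure P]

/-- Bias-variance bound for the mean of truncated independent observations with `p`-th absolute
moment at most `v` and means within `D` of `c`. -/
lemma integral_sq_mean_trunc_sub_le {S : Finset ℕ} (hS : S.Nonempty) {Y : ℕ → Ω → ℝ}
    {τ p v c D : ℝ} (hp1 : 1 ≤ p) (hp2 : p ≤ 2) (hτ : 0 < τ)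
    (hYm : ∀ s, Measurable (Y s)) (hYi : ∀ s ∈ S, Integrable (Y s) P)
    (hindep : (S : Set ℕ).Pairwise fun i j => IndepFun (Y i) (Y j) P)
    (hYp : ∀ s ∈ S, Integrable (fun ω => |Y s ω| ^ p) P)
    (hv : ∀ s ∈ S, ∫ ω, |Y s ω| ^ p ∂P ≤ v) (hc : ∀ s ∈ S, |∫ ω, Y s ω ∂P - c| ≤ D) :
    ∫ ω, ((∑ s ∈ S, trunc τ (Y s ω)) / S.card - c) ^ 2 ∂P
      ≤ τ ^ (2 - p) * v / S.card + 2 * (τ ^ (1 - p) * v) ^ 2 + 2 * D ^ 2 := by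
  have hn : (0 : ℝ) < S.card := by exact_mod_cast hS.card_pos
  set n : ℝ := (S.card : ℝ) with hn_def
  set Z : ℕ → Ω → ℝ := fun s ω => trunc τ (Y s ω) with hZ
  have hZm : ∀ s, Measurable (Z s) := fun s => measurable_trunc.comp (measurable_const.prodMk (hYm s))
  have hZL : ∀ s, MemLp (Z s) 2 P := fun s =>
    MemLp.of_bound (hZm s).aestronglyMeasurable τ (ae_of_all _ fun ω => abs_trunc_le hτ.le _)
  have hZi : ∀ s, Integrable (Z s) P := fun s => (hZL s).integrable (by norm_num)
  have hvar : ∀ s ∈ S, Var[Z s; P] ≤ τ ^ (2 - p) * v := by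
    intro s hs
    refine (variance_le_expectation_sq (hZm s).aestronglyMeasurable).trans ?_
    calc ∫ ω, (Z s ^ 2) ω ∂P ≤ ∫ ω, τ ^ (2 - p) * |Y s ω| ^ p ∂P := by
          refine integral_mono (hZL s).integrable_sq ((hYp s hs).const_mul _) fun ω => ?_
          exact trunc_sq_le hp2 (by linarith) hτ _
      _ = τ ^ (2 - p) * ∫ ω, |Y s ω| ^ p ∂P := integral_const_mul _ _
      _ ≤ τ ^ (2 - p) * v := by gcongr; exact hv s hs
  have hbias : ∀ s ∈ S, |∫ ω, Z s ω ∂P - c| ≤ τ ^ (1 - p) * v + D := by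
    intro s hs
    have h1 : |∫ ω, Y s ω ∂P - ∫ ω, Z s ω ∂P| ≤ τ ^ (1 - p) * v := by
      rw [← integral_sub (hYi s hs) (hZi s)]
      calc |∫ ω, (Y s ω - Z s ω) ∂P| ≤ ∫ ω, |Y s ω - Z s ω| ∂P := abs_integral_le_integral_abs
        _ ≤ ∫ ω, τ ^ (1 - p) * |Y s ω| ^ p ∂P := by
            refine integral_mono ((hYi s hs).sub (hZi s)).abs ((hYp s hs).const_mul _) fun ω => ?_
            exact abs_sub_trunc_le hp1 hτ _
        _ = τ ^ (1 - p) * ∫ ω, |Y s ω| ^ p ∂P := integral_const_mul _ _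
        _ ≤ τ ^ (1 - p) * v := by gcongr; exact hv s hs
    have h2 := hc s hs
    rw [abs_le] at h1 h2 ⊢
    constructor <;> linarith [h1.1, h1.2, h2.1, h2.2]
  set A : Ω → ℝ := ∑ s ∈ S, Z s with hA
  have hAL : MemLp A 2 P := memLp_finsetSum' _ fun s _ => hZL s
  have hVA : Var[A; P] ≤ n * (τ ^ (2 - p) * v) := by
    rw [hA, IndepFun.variance_sum (fun s _ => hZL s)]
    · calc ∑ s ∈ S, Var[Z s; P] ≤ ∑ s ∈ S, τ ^ (2 - p) * v := Finset.sum_le_sum hvar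
        _ = n * (τ ^ (2 - p) * v) := by rw [Finset.sum_const, nsmul_eq_mul]
    · intro i hi j hj hij
      have hm : Measurable (trunc τ) := measurable_trunc.comp (measurable_const.prodMk measurable_id)
      exact (hindep hi hj hij).comp hm hm
  have hEA : |(∫ ω, A ω ∂P) / n - c| ≤ τ ^ (1 - p) * v + D := by
    have e1 : ∫ ω, A ω ∂P = ∑ s ∈ S, ∫ ω, Z s ω ∂P := by
      rw [← integral_finsetSum _ fun s _ => hZi s]
      simp [hA]
    have e2 : (∫ ω, A ω ∂P) / n - c = (∑ s ∈ S, (∫ ω, Z s ω ∂P - c)) / n := by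
      rw [e1, Finset.sum_sub_distrib, Finset.sum_const, nsmul_eq_mul, ← hn_def]
      field_simp
    rw [e2, abs_div, abs_of_pos hn, div_le_iff₀ hn]
    calc |∑ s ∈ S, (∫ ω, Z s ω ∂P - c)| ≤ ∑ s ∈ S, |∫ ω, Z s ω ∂P - c| :=
          Finset.abs_sum_le_sum_abs _ _
      _ ≤ ∑ s ∈ S, (τ ^ (1 - p) * v + D) := Finset.sum_le_sum hbias
      _ = (τ ^ (1 - p) * v + D) * n := by rw [Finset.sum_const, nsmul_eq_mul, mul_comm]
  set W : Ω → ℝ := fun ω => n⁻¹ * A ω - c with hW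
  have hWL : MemLp W 2 P := (hAL.const_mul n⁻¹).sub (memLp_const c)
  have hVW : Var[W; P] ≤ τ ^ (2 - p) * v / n := by
    rw [hW, variance_sub_const (hAL.const_mul n⁻¹).aestronglyMeasurable, variance_const_mul]
    calc n⁻¹ ^ 2 * Var[A; P] ≤ n⁻¹ ^ 2 * (n * (τ ^ (2 - p) * v)) := by gcongr
      _ = τ ^ (2 - p) * v / n := by field_simp
  have hEW : ∫ ω, W ω ∂P = (∫ ω, A ω ∂P) / n - c := by
    rw [hW, integral_sub ((hAL.integrable (by norm_num)).const_mul _) (integrable_const _),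
      integral_const_mul, integral_const, probReal_univ, one_smul, div_eq_inv_mul]
  have hsub := variance_eq_sub hWL
  have hWsq : ∫ ω, ((∑ s ∈ S, trunc τ (Y s ω)) / n - c) ^ 2 ∂P = ∫ ω, (W ^ 2) ω ∂P := by
    refine integral_congr_ae (ae_of_all _ fun ω => ?_)
    simp only [hW, hA, hZ, Pi.pow_apply, Finset.sum_apply, div_eq_inv_mul]
  have hsq : (∫ ω, W ω ∂P) ^ 2 ≤ 2 * (τ ^ (1 - p) * v) ^ 2 + 2 * D ^ 2 := by
    rw [hEW, ← sq_abs]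
    calc |(∫ ω, A ω ∂P) / n - c| ^ 2 ≤ (τ ^ (1 - p) * v + D) ^ 2 := by gcongr
      _ ≤ 2 * (τ ^ (1 - p) * v) ^ 2 + 2 * D ^ 2 := by
          nlinarith [sq_nonneg (τ ^ (1 - p) * v - D)]
  rw [hWsq]
  linarith

/-- At the truncation level `τ = (u n / l)^(1/p)` the squared bias and the variance are both of order
`n^(-2(p-1)/p)`. -/
lemma integral_sq_truncatedMean_sub_le {S : Finset ℕ} (hS : S.Nonempty) {Y : ℕ → Ω → ℝ}
    {p b K l c D : ℝ} (hp1 : 1 ≤ p) (hp2 : p ≤ 2) (hb : 0 < b) (hl : 1 / 2 ≤ l) (hK : 0 ≤ K)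
    (hYm : ∀ s, Measurable (Y s)) (hYi : ∀ s ∈ S, Integrable (Y s) P)
    (hindep : (S : Set ℕ).Pairwise fun i j => IndepFun (Y i) (Y j) P)
    (hYp : ∀ s ∈ S, Integrable (fun ω => |Y s ω| ^ p) P)
    (hv : ∀ s ∈ S, ∫ ω, |Y s ω| ^ p ∂P ≤ K * b ^ p) (hc : ∀ s ∈ S, |∫ ω, Y s ω ∂P - c| ≤ D) :
    ∫ ω, (truncatedMean p (b ^ p) l S (fun s => Y s ω) - c) ^ 2 ∂P
      ≤ 4 * b ^ 2 * (K * l + 2 * K ^ 2 * l ^ 2) * (S.card : ℝ) ^ (-(2 - 2 / p)) + 2 * D ^ 2 := by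
  have hn : (0 : ℝ) < S.card := by exact_mod_cast hS.card_pos
  have hp0 : 0 < p := by linarith
  have hl0 : 0 < l := by linarith
  set n : ℝ := (S.card : ℝ) with hn_def
  set τ : ℝ := (b ^ p * n / l) ^ (1 / p) with hτ_def
  have hτ : 0 < τ := by positivity
  have hτp : τ ^ p = b ^ p * n / l := by
    rw [hτ_def, one_div, Real.rpow_inv_rpow (by positivity) hp0.ne']
  have main := integral_sq_mean_trunc_sub_le (P := P) hS hp1 hp2 hτ hYm hYi hindep hYp hv hc
  have hτ2 : τ ^ 2 / n ^ 2 ≤ 4 * b ^ 2 * n ^ (-(2 - 2 / p)) := by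
    have e1 : τ ^ 2 = b ^ 2 * n ^ (2 / p) * l⁻¹ ^ (2 / p) := by
      rw [hτ_def, ← Real.rpow_two, ← Real.rpow_mul (by positivity), div_eq_mul_inv,
        Real.mul_rpow (by positivity) (by positivity), Real.mul_rpow (by positivity) (by positivity),
        ← Real.rpow_mul hb.le]
      have e3 : p * (1 / p * 2) = 2 := by field_simp
      have e4 : 1 / p * 2 = 2 / p := by ring
      rw [e3, e4, Real.rpow_two]
    have e2 : n ^ (-(2 - 2 / p)) = n ^ (2 / p) / n ^ 2 := by
      rw [neg_sub, Real.rpow_sub hn, Real.rpow_two]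
    have h4 : l⁻¹ ^ (2 / p) ≤ 4 := by
      have h2 : l⁻¹ ≤ 2 := by
        rw [inv_le_comm₀ hl0 two_pos]; linarith
      calc l⁻¹ ^ (2 / p) ≤ 2 ^ (2 / p) := by gcongr
        _ ≤ (2 : ℝ) ^ (2 : ℝ) := by
            refine Real.rpow_le_rpow_of_exponent_le one_le_two ?_
            rw [div_le_iff₀ hp0]; linarith
        _ = 4 := by norm_num
    rw [e1, e2]
    calc b ^ 2 * n ^ (2 / p) * l⁻¹ ^ (2 / p) / n ^ 2 ≤ b ^ 2 * n ^ (2 / p) * 4 / n ^ 2 := by gcongr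
      _ = 4 * b ^ 2 * (n ^ (2 / p) / n ^ 2) := by ring
  have t1 : τ ^ (2 - p) * (K * b ^ p) / n = K * l * (τ ^ 2 / n ^ 2) := by
    rw [Real.rpow_sub hτ, hτp, Real.rpow_two]
    field_simp
  have t2 : (τ ^ (1 - p) * (K * b ^ p)) ^ 2 = K ^ 2 * l ^ 2 * (τ ^ 2 / n ^ 2) := by
    rw [Real.rpow_sub hτ, hτp, Real.rpow_one]
    field_simp
  rw [t1, t2] at main
  have hc0 : 0 ≤ K * l + 2 * K ^ 2 * l ^ 2 := by positivity
  calc ∫ ω, (truncatedMean p (b ^ p) l S (fun s => Y s ω) - c) ^ 2 ∂P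
      ≤ K * l * (τ ^ 2 / n ^ 2) + 2 * (K ^ 2 * l ^ 2 * (τ ^ 2 / n ^ 2)) + 2 * D ^ 2 := main
    _ = (K * l + 2 * K ^ 2 * l ^ 2) * (τ ^ 2 / n ^ 2) + 2 * D ^ 2 := by ring
    _ ≤ (K * l + 2 * K ^ 2 * l ^ 2) * (4 * b ^ 2 * n ^ (-(2 - 2 / p))) + 2 * D ^ 2 := by gcongr
    _ = _ := by ring

end Truncation

/-! ### Geometry of the cells -/

section Cells

lemma one_le_cellsPerAxis {h : ℝ} (hh : 0 < h) : 1 ≤ cellsPerAxis h :=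
  Nat.one_le_iff_ne_zero.2 (Nat.ceil_pos.2 (inv_pos.2 hh)).ne'

lemma one_le_numCells (d : ℕ) {h : ℝ} (hh : 0 < h) : 1 ≤ numCells d h :=
  Nat.one_le_pow _ _ (one_le_cellsPerAxis hh)

lemma cellIndex_lt {d : ℕ} {h : ℝ} (hh : 0 < h) (z : Ctx d) (i : Fin d) :
    cellIndex h z i < cellsPerAxis h := by
  have := one_le_cellsPerAxis hh
  unfold cellIndex
  omega

lemma measurable_cellIndex {d : ℕ} (h : ℝ) : Measurable (cellIndex h : Ctx d → Fin d → ℕ) := by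
  unfold cellIndex
  refine measurable_pi_iff.2 fun i => ?_
  exact (Nat.measurable_floor.comp (by fun_prop)).min measurable_const

/-- A coordinate `a ∈ [0, 1]` in the interval with index `j` satisfies `j h ≤ a ≤ (j + 1) h`; for the
last interval this uses `1 ≤ ⌈1/h⌉ h`. -/
lemma mem_Icc_of_min_floor_eq {h a : ℝ} {j : ℕ} (hh : 0 < h) (ha0 : 0 ≤ a) (ha1 : a ≤ 1)
    (hj : min ⌊a / h⌋₊ (cellsPerAxis h - 1) = j) : j * h ≤ a ∧ a ≤ (j + 1) * h := by
  have hK := one_le_cellsPerAxis hh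
  have hq : 0 ≤ a / h := div_nonneg ha0 hh.le
  constructor
  · rw [← le_div_iff₀ hh]
    have h1 : j ≤ ⌊a / h⌋₊ := hj ▸ min_le_left _ _
    exact (Nat.cast_le.2 h1).trans (Nat.floor_le hq)
  · rw [← div_le_iff₀ hh]
    rcases min_choice ⌊a / h⌋₊ (cellsPerAxis h - 1) with h1 | h1
    · rw [← hj, h1]
      exact (Nat.lt_floor_add_one _).le
    · have h2 : (j : ℝ) + 1 = cellsPerAxis h := by
        rw [← hj, h1]
        push_cast [Nat.cast_sub hK]
        ring
      rw [h2]
      calc a / h ≤ 1 / h := by gcongr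
        _ = h⁻¹ := one_div h
        _ ≤ cellsPerAxis h := Nat.le_ceil _

lemma norm_sub_le_of_cellIndex_eq {d : ℕ} {h : ℝ} (hh : 0 < h) {z z' : Ctx d} (hz : z ∈ unitCube d)
    (hz' : z' ∈ unitCube d) (heq : cellIndex h z = cellIndex h z') : ‖z - z'‖ ≤ √d * h := by
  have hi : ∀ i, ‖(z - z') i‖ ≤ h := by
    intro i
    obtain ⟨a1, a2⟩ := mem_Icc_of_min_floor_eq hh (hz i).1 (hz i).2 rfl
    obtain ⟨b1, b2⟩ := mem_Icc_of_min_floor_eq hh (hz' i).1 (hz' i).2 (congrFun heq i).symm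
    change ‖z i - z' i‖ ≤ h
    unfold cellIndex at b1 b2
    rw [Real.norm_eq_abs, abs_le]
    constructor <;> linarith
  rw [EuclideanSpace.norm_eq]
  calc √(∑ i, ‖(z - z') i‖ ^ 2) ≤ √(∑ _i : Fin d, h ^ 2) := by
        gcongr with i
        exact hi i
    _ = √d * h := by
        rw [Finset.sum_const, Finset.card_univ, Fintype.card_fin, nsmul_eq_mul,
          Real.sqrt_mul (Nat.cast_nonneg d), Real.sqrt_sq hh.le]

lemma HolderOnCube.abs_sub_le_of_cellIndex_eq {d : ℕ} {β H h : ℝ} {m : Ctx d → ℝ}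
    (hm : HolderOnCube β H m) (hβ : 0 < β) (hH : 0 ≤ H) (hh : 0 < h) {z z' : Ctx d}
    (hz : z ∈ unitCube d) (hz' : z' ∈ unitCube d) (heq : cellIndex h z = cellIndex h z') :
    |m z - m z'| ≤ H * (√d * h) ^ β := by
  refine (hm z hz z' hz').trans ?_
  gcongr
  exact norm_sub_le_of_cellIndex_eq hh hz hz' heq

end Cells

/-! ### The regret of one round for deterministic contexts -/

section FixedDesign

lemma cellSample_eq_empty_of_epoch_le_one {d : ℕ} (h : ℝ) (z : ℕ → Ctx d) {t : ℕ}
    (ht : epoch t ≤ 1) : cellSample h z t = ∅ := by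
  have : epoch t - 1 = 0 := by omega
  simp [cellSample, epochRounds, this]

lemma notMem_epochRounds_self {t : ℕ} (ht : 1 ≤ t) : t ∉ epochRounds (epoch t - 1) := by
  unfold epochRounds epoch
  rw [Finset.mem_Ico, Nat.add_sub_cancel]
  intro h
  exact absurd (Nat.pow_log_le_self 2 (by omega)) (not_le.2 h.2)

lemma rpow_abs_avg_le {B p c a b : ℝ} (hB : 0 ≤ B) (hc : |c| ≤ B) (hp0 : 0 < p) (hp2 : p ≤ 2) :
    |(c + a + (c + b)) / 2| ^ p ≤ 9 * (B ^ p + |a| ^ p + |b| ^ p) := by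
  set M := max B (max |a| |b|) with hM
  have hM0 : 0 ≤ M := hB.trans (le_max_left _ _)
  have hBM : B ≤ M := le_max_left _ _
  have haM : |a| ≤ M := (le_max_left _ _).trans (le_max_right _ _)
  have hbM : |b| ≤ M := (le_max_right _ _).trans (le_max_right _ _)
  have h1 : |(c + a + (c + b)) / 2| ≤ 3 * M := by
    have ha := abs_le.1 haM
    have hb := abs_le.1 hbM
    have hc' := abs_le.1 hc
    rw [abs_le]
    constructor <;> linarith [ha.1, ha.2, hb.1, hb.2, hc'.1, hc'.2]
  have h2 : M ^ p ≤ B ^ p + |a| ^ p + |b| ^ p := by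
    have e1 : 0 ≤ B ^ p := by positivity
    have e2 : 0 ≤ |a| ^ p := by positivity
    have e3 : 0 ≤ |b| ^ p := by positivity
    rcases max_choice B (max |a| |b|) with h | h
    · rw [hM, h]; linarith
    · rcases max_choice |a| |b| with h' | h' <;> rw [hM, h, h'] <;> linarith
  calc |(c + a + (c + b)) / 2| ^ p ≤ (3 * M) ^ p := by gcongr
    _ = 3 ^ p * M ^ p := Real.mul_rpow (by norm_num) hM0
    _ ≤ 3 ^ (2 : ℝ) * M ^ p := by
        gcongr
        norm_num
    _ = 9 * M ^ p := by norm_num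
    _ ≤ _ := by gcongr

/-- The coefficient of the statistical error in the regret of a round: `2 + 2 σ^p` bounds `E|ξ - ζ|`,
the cost of a cell without observations, and the rest comes from the mean squared error of the truncated
mean with `27 b^p` as the bound on the `p`-th moments. -/
def errorCoeff (L b σ p l : ℝ) : ℝ :=
  2 + 2 * σ ^ p + 16 * L * b ^ 2 * (27 * l + 2 * 27 ^ 2 * l ^ 2)

variable {Ω : Type*} {d : ℕ} {β H B L p σ μ₀ π₀ : ℝ} {T t : ℕ} {m : Ctx d → ℝ}
  {x : ℕ → Ω → Ctx d} {ξ ζ : ℕ → Ω → ℝ}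

lemma abs_roundRegret_le (ω : Ω) :
    |roundRegret β B p σ π₀ T m x ξ ζ t ω| ≤ |ξ t ω - ζ t ω| := by
  refine (abs_gain_sub_gain_le _ _ _ _).trans_eq ?_
  simp only [valuation]
  congr 1
  ring

variable [MeasurableSpace Ω] {P : Measure Ω}

lemma IsEnvironment.integrable_abs_sub (env : IsEnvironment P β H B L p σ μ₀ m x ξ ζ) (t : ℕ) :
    Integrable (fun ω => |ξ t ω - ζ t ω|) P :=
  ((env.noise_xi t).integrable.sub (env.noise_zeta t).integrable).abs

lemma IsEnvironment.iIndepFun_noise (env : IsEnvironment P β H B L p σ μ₀ m x ξ ζ) :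
    iIndepFun (fun t ω => (ξ t ω, ζ t ω)) P :=
  env.indep_rounds.comp (fun _ => Prod.snd) fun _ => measurable_snd

lemma IsEnvironment.measurable_noise (env : IsEnvironment P β H B L p σ μ₀ m x ξ ζ) (t : ℕ) :
    Measurable (fun ω => (ξ t ω, ζ t ω)) :=
  (env.noise_xi t).measurable.prodMk (env.noise_zeta t).measurable

/-- The price in round `t` is a function of earlier noises, so with the contexts fixed it is
independent of the noise in round `t`. -/
lemma IsEnvironment.indepFun_truncatedMean (env : IsEnvironment P β H B L p σ μ₀ m x ξ ζ)
    {S : Finset ℕ} (htS : t ∉ S) (u l : ℝ) (c : ℕ → ℝ) :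
    IndepFun (fun ω => truncatedMean p u l S (fun s => (c s + ξ s ω + (c s + ζ s ω)) / 2))
      (fun ω => (ξ t ω, ζ t ω)) P := by
  have h1 := env.iIndepFun_noise.indepFun_finset S {t} (Finset.disjoint_singleton_right.2 htS)
    env.measurable_noise
  have hφ : Measurable (fun g : S → ℝ × ℝ =>
      (∑ s : S, trunc ((u * (S.card : ℝ) / l) ^ (1 / p)) ((c s + (g s).1 + (c s + (g s).2)) / 2))
        / (S.card : ℝ)) := by
    refine (Finset.measurable_sum _ fun s _ => ?_).div_const _
    exact measurable_trunc.comp (measurable_const.prodMk (by fun_prop))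
  have hψ : Measurable (fun g : ({t} : Finset ℕ) → ℝ × ℝ => g ⟨t, Finset.mem_singleton_self t⟩) :=
    measurable_pi_apply _
  have h2 := h1.comp hφ hψ
  convert h2 using 1
  · funext ω
    simp only [truncatedMean, Function.comp]
    congr 1
    exact (Finset.sum_coe_sort S fun s =>
      trunc ((u * (S.card : ℝ) / l) ^ (1 / p)) ((c s + ξ s ω + (c s + ζ s ω)) / 2)).symm
  · rfl

variable [IsProbabilityMeasure P]

lemma IsNoise.integral_abs_le {X : Ω → ℝ} (hX : IsNoise P L p σ X) (hp : 1 ≤ p) :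
    ∫ ω, |X ω| ∂P ≤ 1 + σ ^ p := by
  calc ∫ ω, |X ω| ∂P ≤ ∫ ω, (1 + |X ω| ^ p) ∂P := by
        refine integral_mono hX.integrable.abs ((integrable_const _).add hX.integrable_rpow)
          fun ω => ?_
        rcases le_total |X ω| 1 with h | h
        · have : 0 ≤ |X ω| ^ p := by positivity
          change |X ω| ≤ 1 + |X ω| ^ p
          linarith
        · have := Real.self_le_rpow_of_one_le h hp
          change |X ω| ≤ 1 + |X ω| ^ p
          linarith
    _ = 1 + ∫ ω, |X ω| ^ p ∂P := by
        rw [integral_add (integrable_const _) hX.integrable_rpow]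
        simp
    _ ≤ 1 + σ ^ p := by gcongr; exact hX.moment

lemma IsEnvironment.integral_abs_sub_le (env : IsEnvironment P β H B L p σ μ₀ m x ξ ζ)
    (hp : 1 ≤ p) (t : ℕ) : ∫ ω, |ξ t ω - ζ t ω| ∂P ≤ 2 + 2 * σ ^ p := by
  calc ∫ ω, |ξ t ω - ζ t ω| ∂P ≤ ∫ ω, (|ξ t ω| + |ζ t ω|) ∂P :=
        integral_mono (env.integrable_abs_sub t)
          ((env.noise_xi t).integrable.abs.add (env.noise_zeta t).integrable.abs)
          fun ω => abs_sub _ _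
    _ = ∫ ω, |ξ t ω| ∂P + ∫ ω, |ζ t ω| ∂P :=
        integral_add (env.noise_xi t).integrable.abs (env.noise_zeta t).integrable.abs
    _ ≤ 2 + 2 * σ ^ p := by
        linarith [(env.noise_xi t).integral_abs_le hp, (env.noise_zeta t).integral_abs_le hp]

lemma memLp_truncatedMean {u l : ℝ} (hu : 0 ≤ u) (hl : 0 ≤ l) (S : Finset ℕ)
    {Y : ℕ → Ω → ℝ} (hY : ∀ s, Measurable (Y s)) :
    MemLp (fun ω => truncatedMean p u l S (fun s => Y s ω)) 2 P := by
  have h1 : MemLp (fun ω => ∑ s ∈ S, trunc ((u * (S.card : ℝ) / l) ^ (1 / p)) (Y s ω)) 2 P := by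
    refine memLp_finsetSum S fun s _ => MemLp.of_bound ?_ ((u * (S.card : ℝ) / l) ^ (1 / p))
      (ae_of_all _ fun ω => abs_trunc_le (by positivity) _)
    exact (measurable_trunc.comp (measurable_const.prodMk (hY s))).aestronglyMeasurable
  have h2 := h1.const_mul (S.card : ℝ)⁻¹
  simpa only [truncatedMean, trunc, div_eq_inv_mul] using h2

lemma rpow_neg_le_two_mul {n a : ℝ} (hn : 1 ≤ n) (ha0 : 0 ≤ a) (ha1 : a ≤ 1) :
    n ^ (-a) ≤ 2 * (n + 1) ^ (-a) := by
  have hn0 : 0 < n := by linarith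
  calc n ^ (-a) = 2 ^ a * (2 * n) ^ (-a) := by
        rw [Real.mul_rpow two_pos.le hn0.le, ← mul_assoc, ← Real.rpow_add two_pos, add_neg_cancel,
          Real.rpow_zero, one_mul]
    _ ≤ 2 ^ (1 : ℝ) * (n + 1) ^ (-a) := by
        gcongr ?_ * ?_
        · exact Real.rpow_le_rpow_of_exponent_le one_le_two ha1
        · exact Real.rpow_le_rpow_of_nonpos (by linarith) (by linarith) (by linarith)
    _ = 2 * (n + 1) ^ (-a) := by rw [Real.rpow_one]

/-- Moment bound for the observations, which are `m(z_s)` plus the average of the two noises. -/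
lemma IsEnvironment.observation_moment (env : IsEnvironment P β H B L p σ μ₀ m x ξ ζ)
    (hB : 0 ≤ B) (hσ : 0 < σ) (hp0 : 0 < p) (hp2 : p ≤ 2) {c : ℝ} (hc : |c| ≤ B) (s : ℕ) :
    Integrable (fun ω => |(c + ξ s ω + (c + ζ s ω)) / 2| ^ p) P ∧
      ∫ ω, |(c + ξ s ω + (c + ζ s ω)) / 2| ^ p ∂P ≤ 27 * (B + σ) ^ p := by
  have hX := env.noise_xi s
  have hY := env.noise_zeta s
  have hXm := hX.measurable
  have hYm := hY.measurable
  have i2 : Integrable (fun ω => B ^ p + |ξ s ω| ^ p + |ζ s ω| ^ p) P :=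
    ((integrable_const _).add hX.integrable_rpow).add hY.integrable_rpow
  have i3 := i2.const_mul 9
  have hle : ∀ ω, |(c + ξ s ω + (c + ζ s ω)) / 2| ^ p
      ≤ 9 * (B ^ p + |ξ s ω| ^ p + |ζ s ω| ^ p) := fun ω => rpow_abs_avg_le hB hc hp0 hp2
  have i1 : Integrable (fun ω => |(c + ξ s ω + (c + ζ s ω)) / 2| ^ p) P := by
    refine i3.mono' (Measurable.aestronglyMeasurable (by fun_prop)) (ae_of_all _ fun ω => ?_)
    rw [Real.norm_eq_abs, abs_of_nonneg (by positivity)]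
    exact hle ω
  refine ⟨i1, (integral_mono i1 i3 hle).trans ?_⟩
  have i4 : Integrable (fun ω => B ^ p + |ξ s ω| ^ p) P :=
    (integrable_const _).add hX.integrable_rpow
  rw [integral_const_mul, integral_add i4 hY.integrable_rpow,
    integral_add (integrable_const _) hX.integrable_rpow, integral_const, probReal_univ, one_smul]
  have h1 : B ^ p ≤ (B + σ) ^ p := by gcongr; linarith
  have h2 : σ ^ p ≤ (B + σ) ^ p := by gcongr; linarith
  linarith [hX.moment, hY.moment]

lemma half_le_log_numCells_mul {h : ℝ} (hh : 0 < h) (hT : 2 ≤ T) :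
    1 / 2 ≤ Real.log ((numCells d h : ℝ) * T) := by
  have h1 : (1 : ℝ) ≤ numCells d h := by exact_mod_cast one_le_numCells d hh
  have h2 : (2 : ℝ) ≤ T := by exact_mod_cast hT
  calc (1 : ℝ) / 2 ≤ Real.log 2 := by linarith [Real.log_two_gt_d9]
    _ ≤ Real.log ((numCells d h : ℝ) * T) := Real.log_le_log two_pos (by nlinarith)

lemma sideLength_pos (hT : 2 ≤ T) : 0 < sideLength d β p T :=
  Real.rpow_pos_of_pos (by exact_mod_cast (by omega : 0 < T)) _

/-- The expected regret of round `t` when the contexts form a fixed sequence `z`: an approximation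
error from the size of the cells, and a statistical error from the number of observations. -/
lemma IsEnvironment.integral_roundRegret_const_le
    (env : IsEnvironment P β H B L p σ μ₀ m x ξ ζ) (hβ : 0 < β) (hH : 0 ≤ H) (hB : 0 ≤ B)
    (hL : 0 ≤ L) (hσ : 0 < σ) (hp1 : 1 < p) (hp2 : p ≤ 2) (hT : 2 ≤ T) (ht : 1 ≤ t)
    {z : ℕ → Ctx d} (hz : ∀ s, z s ∈ unitCube d) :
    ∫ ω, roundRegret β B p σ π₀ T m (fun s _ => z s) ξ ζ t ω ∂P
      ≤ 4 * L * (H * (√d * sideLength d β p T) ^ β) ^ 2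
        + errorCoeff L (B + σ) σ p
            (Real.log ((numCells d (sideLength d β p T) : ℝ) * (T : ℝ)))
          * ((cellSample (sideLength d β p T) z t).card + 1 : ℝ) ^ (-(2 - 2 / p)) := by
  set h := sideLength d β p T with hh_def
  have hh : 0 < h := sideLength_pos hT
  set l := Real.log ((numCells d h : ℝ) * (T : ℝ)) with hl_def
  have hl : 1 / 2 ≤ l := half_le_log_numCells_mul hh hT
  have hl0 : 0 < l := by linarith
  have hp0 : 0 < p := by linarith
  have hb : 0 < B + σ := by linarith
  set S := cellSample h z t with hS_def
  set c := m (z t) with hc_def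
  have hσp : 0 < σ ^ p := by positivity
  rcases S.eq_empty_or_nonempty with hS | hS
  · have h1 : ∫ ω, roundRegret β B p σ π₀ T m (fun s _ => z s) ξ ζ t ω ∂P ≤ 2 + 2 * σ ^ p := by
      refine le_trans ?_ (env.integral_abs_sub_le hp1.le t)
      exact (le_abs_self _).trans (abs_integral_le_integral_abs.trans
        (integral_mono_of_nonneg (ae_of_all _ fun ω => abs_nonneg _) (env.integrable_abs_sub t)
          (ae_of_all _ fun ω => abs_roundRegret_le ω)))
    rw [hS, Finset.card_empty, Nat.cast_zero, zero_add, Real.one_rpow, mul_one]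
    have h2 : 0 ≤ 16 * L * (B + σ) ^ 2 * (27 * l + 2 * 27 ^ 2 * l ^ 2) := by positivity
    have h3 : 0 ≤ 4 * L * (H * (√d * h) ^ β) ^ 2 := by positivity
    unfold errorCoeff
    linarith
  · have hepoch : ¬ (epoch t ≤ 1 ∨ S = ∅) := by
      rintro (h1 | h1)
      · exact hS.ne_empty (cellSample_eq_empty_of_epoch_le_one h z h1)
      · exact hS.ne_empty h1
    have htS : t ∉ S := fun h1 => notMem_epochRounds_self ht (Finset.mem_filter.1 h1).1
    set Y : ℕ → Ω → ℝ := fun s ω => (m (z s) + ξ s ω + (m (z s) + ζ s ω)) / 2 with hY_def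
    set Q : Ω → ℝ := fun ω => truncatedMean p ((B + σ) ^ p) l S (fun s => Y s ω) with hQ_def
    have hYm : ∀ s, Measurable (Y s) := fun s => by
      have h1 := (env.noise_xi s).measurable
      have h2 := (env.noise_zeta s).measurable
      fun_prop
    have hQL : MemLp Q 2 P := memLp_truncatedMean (by positivity) hl0.le S hYm
    have hQm : Measurable Q := by
      have h1 : Measurable fun ω =>
          (∑ s ∈ S, trunc (((B + σ) ^ p * (S.card : ℝ) / l) ^ (1 / p)) (Y s ω)) / (S.card : ℝ) := by
        refine (Finset.measurable_sum _ fun s _ => ?_).div_const _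
        exact measurable_trunc.comp (measurable_const.prodMk (hYm s))
      exact h1
    have hrr : ∀ ω, roundRegret β B p σ π₀ T m (fun s _ => z s) ξ ζ t ω
        = gain c (c + ξ t ω) (c + ζ t ω) - gain (Q ω) (c + ξ t ω) (c + ζ t ω) := by
      intro ω
      simp only [roundRegret, price, valuation]
      rw [if_neg hepoch]
    have hf : Measurable (Function.uncurry fun (q : ℝ) (y : ℝ × ℝ) =>
        gain c (c + y.1) (c + y.2) - gain q (c + y.1) (c + y.2)) := by
      refine Measurable.sub ?_ ?_
      · exact measurable_gain.comp (f := fun r : ℝ × ℝ × ℝ => (c, c + r.2.1, c + r.2.2))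
          (by fun_prop)
      · exact measurable_gain.comp (f := fun r : ℝ × ℝ × ℝ => (r.1, c + r.2.1, c + r.2.2))
          (by fun_prop)
    have hbi : Integrable (fun ω => 2 * L * (Q ω - c) ^ 2) P :=
      ((hQL.sub (memLp_const c)).integrable_sq).const_mul _
    have hfi : Integrable (fun ω =>
        gain c (c + ξ t ω) (c + ζ t ω) - gain (Q ω) (c + ξ t ω) (c + ζ t ω)) P := by
      refine (env.integrable_abs_sub t).mono'
        (hf.comp (hQm.prodMk (env.measurable_noise t))).aestronglyMeasurable
        (ae_of_all _ fun ω => ?_)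
      refine (abs_gain_sub_gain_le _ _ _ _).trans_eq ?_
      rw [add_sub_add_left_eq_sub]
    have step1 : ∫ ω, roundRegret β B p σ π₀ T m (fun s _ => z s) ξ ζ t ω ∂P
        ≤ ∫ ω, 2 * L * (Q ω - c) ^ 2 ∂P := by
      simp_rw [hrr]
      exact integral_le_of_indepFun (X := Q) (Y := fun ω => (ξ t ω, ζ t ω))
        (b := fun q => 2 * L * (q - c) ^ 2) hQm (env.measurable_noise t)
        (env.indepFun_truncatedMean htS _ _ fun s => m (z s)) hf hfi hbi
        fun ω' => integral_gain_sub_gain_le hL (env.noise_xi t) (env.noise_zeta t)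
          (env.indep_noise t) c (Q ω')
    have hYi : ∀ s, Integrable (Y s) P := fun s =>
      (((integrable_const _).add (env.noise_xi s).integrable).add
        ((integrable_const _).add (env.noise_zeta s).integrable)).div_const 2
    have hYmean : ∀ s, ∫ ω, Y s ω ∂P = m (z s) := by
      intro s
      have e : ∀ ω, Y s ω = m (z s) + (1 / 2 * ξ s ω + 1 / 2 * ζ s ω) := fun ω => by
        simp only [hY_def]; ring
      have i1 := (env.noise_xi s).integrable.const_mul (1 / 2)
      have i2 := (env.noise_zeta s).integrable.const_mul (1 / 2)
      have i3 : Integrable (fun ω => 1 / 2 * ξ s ω + 1 / 2 * ζ s ω) P := i1.add i2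
      simp_rw [e]
      rw [integral_add (integrable_const _) i3, integral_add i1 i2, integral_const_mul,
        integral_const_mul, (env.noise_xi s).mean_zero, (env.noise_zeta s).mean_zero]
      simp
    have hYind : (S : Set ℕ).Pairwise fun i j => IndepFun (Y i) (Y j) P := by
      intro i _ j _ hij
      exact (env.iIndepFun_noise.indepFun hij).comp
        (φ := fun q : ℝ × ℝ => (m (z i) + q.1 + (m (z i) + q.2)) / 2)
        (ψ := fun q : ℝ × ℝ => (m (z j) + q.1 + (m (z j) + q.2)) / 2) (by fun_prop) (by fun_prop)
    have hmom := fun s => env.observation_moment hB hσ hp0 hp2 (env.bounded _ (hz s)) s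
    have step2 := integral_sq_truncatedMean_sub_le (P := P) hS hp1.le hp2 hb hl
      (by norm_num : (0 : ℝ) ≤ 27) hYm (fun s _ => hYi s) hYind (fun s _ => (hmom s).1)
      (fun s _ => (hmom s).2) (c := c) (D := H * (√d * h) ^ β) (by
        intro s hs
        rw [hYmean]
        exact env.holder.abs_sub_le_of_cellIndex_eq hβ hH hh (hz s) (hz t)
          (Finset.mem_filter.1 hs).2)
    have hn : (1 : ℝ) ≤ S.card := by exact_mod_cast hS.card_pos
    have h2p1 : 1 ≤ 2 / p := by rw [le_div_iff₀ hp0]; linarith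
    have h2p2 : 2 / p ≤ 2 := by rw [div_le_iff₀ hp0]; linarith
    have hpow := rpow_neg_le_two_mul hn (by linarith : 0 ≤ 2 - 2 / p) (by linarith)
    rw [integral_const_mul] at step1
    have hpos : 0 ≤ (S.card + 1 : ℝ) ^ (-(2 - 2 / p)) := by positivity
    calc ∫ ω, roundRegret β B p σ π₀ T m (fun s _ => z s) ξ ζ t ω ∂P
        ≤ 2 * L * (4 * (B + σ) ^ 2 * (27 * l + 2 * 27 ^ 2 * l ^ 2)
            * (S.card : ℝ) ^ (-(2 - 2 / p)) + 2 * (H * (√d * h) ^ β) ^ 2) :=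
          step1.trans (by gcongr)
      _ ≤ 2 * L * (4 * (B + σ) ^ 2 * (27 * l + 2 * 27 ^ 2 * l ^ 2)
            * (2 * (S.card + 1 : ℝ) ^ (-(2 - 2 / p))) + 2 * (H * (√d * h) ^ β) ^ 2) := by gcongr
      _ = 4 * L * (H * (√d * h) ^ β) ^ 2 + 16 * L * (B + σ) ^ 2 * (27 * l + 2 * 27 ^ 2 * l ^ 2)
            * (S.card + 1 : ℝ) ^ (-(2 - 2 / p)) := by ring
      _ ≤ _ := by
          unfold errorCoeff
          gcongr
          linarith

end FixedDesign

/-! ### The number of observations in the cell of the current context -/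

section Counting

lemma sum_inv_card_fiber_le {ι : Type*} [DecidableEq ι] (A : Finset ℕ) (G : Finset ι) (z : ℕ → ι)
    (hG : ∀ s ∈ A, z s ∈ G) :
    ∑ s ∈ A, ((A.filter fun r => z r = z s).card : ℝ)⁻¹ ≤ G.card := by
  rw [← Finset.sum_fiberwise_of_maps_to hG, Finset.card_eq_sum_ones, Nat.cast_sum]
  refine Finset.sum_le_sum fun g _ => ?_
  have h1 : ∑ s ∈ A.filter (fun s => z s = g), ((A.filter fun r => z r = z s).card : ℝ)⁻¹
      = ∑ s ∈ A.filter (fun s => z s = g), ((A.filter fun r => z r = g).card : ℝ)⁻¹ :=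
    Finset.sum_congr rfl fun s hs => by rw [(Finset.mem_filter.1 hs).2]
  rw [h1, Finset.sum_const, nsmul_eq_mul, Nat.cast_one]
  exact mul_inv_le_one

lemma measurable_card_filter_eq {ι α : Type*} [MeasurableSpace ι] [MeasurableEq ι] [DecidableEq ι]
    [MeasurableSpace α] (A : Finset ℕ) (t : ℕ) {z : ℕ → α → ι} (hz : ∀ s, Measurable (z s)) :
    Measurable fun a => ((A.filter fun r => z r a = z t a).card : ℝ) := by
  simp_rw [Finset.card_filter, Nat.cast_sum]
  refine Finset.measurable_sum _ fun r _ => ?_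
  have : Measurable fun a => if z r a = z t a then (1 : ℝ) else 0 :=
    Measurable.ite (measurableSet_eq_fun (hz r) (hz t)) measurable_const measurable_const
  simpa using this

variable {Ω : Type*} [MeasurableSpace Ω] {P : Measure Ω} {d : ℕ} {x : ℕ → Ω → Ctx d} {μ₀ : ℝ}

lemma IsContextProcess.identDistrib (hx : IsContextProcess P μ₀ x) (i j : ℕ) :
    IdentDistrib (x i) (x j) P P where
  aemeasurable_fst := (hx.measurable i).aemeasurable
  aemeasurable_snd := (hx.measurable j).aemeasurable
  map_eq := by
    obtain ⟨q, -, -, hq⟩ := hx.density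
    rw [hq i, hq j]

lemma measurable_cellSample_card {α : Type*} [MeasurableSpace α] {x : ℕ → α → Ctx d} (h : ℝ)
    (hx : ∀ s, Measurable (x s)) (t : ℕ) :
    Measurable fun a => ((cellSample h (fun s => x s a) t).card : ℝ) :=
  measurable_card_filter_eq _ t (z := fun s a => cellIndex h (x s a))
    fun s => (measurable_cellIndex h).comp (hx s)

variable [IsProbabilityMeasure P]

/-- For i.i.d. labels in a finite set `G`, the expected reciprocal of the number of rounds of `A`
that share the label of round `t ∈ A` is at most `|G| / |A|`: by exchangeability it does not depend
on `t`, and summed over `t ∈ A` these reciprocals count the labels that occur. -/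
lemma integral_inv_card_le {ι : Type*} [MeasurableSpace ι] [MeasurableEq ι] [DecidableEq ι]
    {c : ℕ → Ω → ι} (hc : ∀ s, Measurable (c s)) (hind : iIndepFun c P)
    (hid : ∀ i j, IdentDistrib (c i) (c j) P P) {G : Finset ι} (hG : ∀ s ω, c s ω ∈ G)
    {A : Finset ℕ} {t : ℕ} (ht : t ∈ A) :
    ∫ ω, ((A.filter fun r => c r ω = c t ω).card : ℝ)⁻¹ ∂P ≤ G.card / A.card := by
  have hA : (0 : ℝ) < A.card := by exact_mod_cast Finset.card_pos.2 ⟨t, ht⟩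
  have hint : ∀ s, Integrable (fun ω => ((A.filter fun r => c r ω = c s ω).card : ℝ)⁻¹) P := by
    intro s
    refine Integrable.of_bound (measurable_card_filter_eq A s hc).inv.aestronglyMeasurable 1
      (ae_of_all _ fun ω => ?_)
    rw [Real.norm_eq_abs, abs_of_nonneg (by positivity)]
    exact Nat.cast_inv_le_one _
  have hexch : ∀ s ∈ A, ∫ ω, ((A.filter fun r => c r ω = c s ω).card : ℝ)⁻¹ ∂P
      = ∫ ω, ((A.filter fun r => c r ω = c t ω).card : ℝ)⁻¹ ∂P := by
    intro s hs
    -- Exchanging the labels of rounds `s` and `t` preserves the joint law and maps `A` to itself.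
    set e : Equiv.Perm ℕ := Equiv.swap s t with he
    have h1 : IdentDistrib (fun ω i => c i ω) (fun ω i => c (e i) ω) P P :=
      IdentDistrib.pi (fun i => hid i (e i)) hind (hind.precomp e.injective)
    have hF : Measurable fun z : ℕ → ι => ((A.filter fun r => z r = z t).card : ℝ)⁻¹ :=
      (measurable_card_filter_eq (z := fun s (z : ℕ → ι) => z s) A t measurable_pi_apply).inv
    have h2 := (h1.comp hF).integral_eq
    refine Eq.trans ?_ h2.symm
    refine integral_congr_ae (ae_of_all _ fun ω => ?_)
    simp only [Function.comp]
    congr 2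
    have heA : ∀ r, e r ∈ A ↔ r ∈ A := by
      intro r
      rw [he, Equiv.swap_apply_def]
      split_ifs with h3 h4
      · subst h3; exact ⟨fun _ => hs, fun _ => ht⟩
      · subst h4; exact ⟨fun _ => ht, fun _ => hs⟩
      · exact Iff.rfl
    refine Finset.card_equiv e fun r => ?_
    rw [Finset.mem_filter, Finset.mem_filter, heA]
    simp [he]
  rw [le_div_iff₀ hA]
  calc (∫ ω, ((A.filter fun r => c r ω = c t ω).card : ℝ)⁻¹ ∂P) * A.card
      = ∑ s ∈ A, ∫ ω, ((A.filter fun r => c r ω = c s ω).card : ℝ)⁻¹ ∂P := by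
        rw [Finset.sum_congr rfl hexch, Finset.sum_const, nsmul_eq_mul, mul_comm]
    _ = ∫ ω, ∑ s ∈ A, ((A.filter fun r => c r ω = c s ω).card : ℝ)⁻¹ ∂P :=
        (integral_finsetSum _ fun s _ => hint s).symm
    _ ≤ ∫ _ω, (G.card : ℝ) ∂P := by
        refine integral_mono (integrable_finsetSum _ fun s _ => hint s) (integrable_const _)
          fun ω => ?_
        exact sum_inv_card_fiber_le A G (fun s => c s ω) fun s _ => hG s ω
    _ = G.card := by simp

/-- A tangent-line substitute for Jensen's inequality for the concave function `y ↦ y ^ a`. -/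
lemma rpow_le_add_mul {y lam a : ℝ} (hy : 0 < y) (hlam : 0 < lam) (ha0 : 0 ≤ a) (ha1 : a ≤ 1) :
    y ^ a ≤ lam ^ a + lam ^ (a - 1) * y := by
  rcases le_total y lam with h | h
  · have h1 : y ^ a ≤ lam ^ a := by gcongr
    have h2 : 0 ≤ lam ^ (a - 1) * y := by positivity
    linarith
  · have h1 : y ^ (a - 1) ≤ lam ^ (a - 1) :=
      Real.rpow_le_rpow_of_nonpos hlam h (by linarith)
    have h2 : y ^ a = y ^ (a - 1) * y := by
      rw [← Real.rpow_add_one hy.ne', sub_add_cancel]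
    have h3 : 0 ≤ lam ^ a := by positivity
    rw [h2]
    nlinarith

lemma IsContextProcess.integrable_card_rpow (hx : IsContextProcess P μ₀ x) (h : ℝ) (t : ℕ) {a : ℝ}
    (ha : 0 ≤ a) :
    Integrable (fun ω => ((cellSample h (fun s => x s ω) t).card + 1 : ℝ) ^ (-a)) P := by
  have hm := measurable_cellSample_card h hx.measurable t
  refine Integrable.of_bound ((hm.add_const 1).pow_const (-a)).aestronglyMeasurable 1
    (ae_of_all _ fun ω => ?_)
  rw [Real.norm_eq_abs, abs_of_nonneg (by positivity)]
  exact Real.rpow_le_one_of_one_le_of_nonpos (by simp) (by linarith)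

/-- The previous epoch has at least `t / 4 - 1` rounds; the `+ 1` covers `t = 1`, where it is empty. -/
lemma le_four_mul_card_epochRounds {t : ℕ} (ht : 1 ≤ t) :
    t ≤ 4 * ((epochRounds (epoch t - 1)).card + 1) := by
  have h1 : t < 2 ^ (Nat.log 2 t + 1) := Nat.lt_pow_succ_log_self one_lt_two t
  unfold epochRounds epoch
  rw [Nat.card_Ico, Nat.add_sub_cancel]
  rcases Nat.eq_zero_or_pos (Nat.log 2 t) with h0 | h0
  · rw [h0] at h1 ⊢
    omega
  · obtain ⟨k, hk⟩ := Nat.exists_eq_succ_of_ne_zero h0.ne'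
    rw [hk] at h1 ⊢
    simp only [Nat.succ_eq_add_one, Nat.add_sub_cancel, pow_succ] at h1 ⊢
    omega

lemma IsContextProcess.integral_card_rpow_le (hx : IsContextProcess P μ₀ x) (hind : iIndepFun x P)
    {h : ℝ} (hh : 0 < h) {t : ℕ} (ht : 1 ≤ t) {a : ℝ} (ha0 : 0 ≤ a) (ha1 : a ≤ 1) :
    ∫ ω, ((cellSample h (fun s => x s ω) t).card + 1 : ℝ) ^ (-a) ∂P
      ≤ 2 * (4 * numCells d h / t) ^ a := by
  have hM : (1 : ℝ) ≤ numCells d h := by exact_mod_cast one_le_numCells d hh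
  have ht0 : (0 : ℝ) < t := by exact_mod_cast ht
  set lam : ℝ := 4 * numCells d h / t with hlam_def
  have hlam : 0 < lam := by positivity
  set A := insert t (epochRounds (epoch t - 1)) with hA
  have hcard : ∀ ω, ((cellSample h (fun s => x s ω) t).card + 1 : ℝ)
      = ((A.filter fun r => cellIndex h (x r ω) = cellIndex h (x t ω)).card : ℝ) := by
    intro ω
    rw [hA, Finset.filter_insert, if_pos rfl, Finset.card_insert_of_notMem]
    · simp [cellSample]
    · exact fun hmem => notMem_epochRounds_self ht (Finset.mem_filter.1 hmem).1
  have hcI := measurable_cellIndex (d := d) h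
  have hinv : ∫ ω, ((cellSample h (fun s => x s ω) t).card + 1 : ℝ)⁻¹ ∂P ≤ lam := by
    simp_rw [hcard]
    have h1 := integral_inv_card_le (P := P) (c := fun s ω => cellIndex h (x s ω))
      (fun s => hcI.comp (hx.measurable s)) (hind.comp (fun _ => cellIndex h) fun _ => hcI)
      (fun i j => (hx.identDistrib i j).comp hcI)
      (G := Fintype.piFinset fun _ => Finset.range (cellsPerAxis h))
      (fun s ω => Fintype.mem_piFinset.2 fun i => Finset.mem_range.2 (cellIndex_lt hh _ i))
      (Finset.mem_insert_self t (epochRounds (epoch t - 1)))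
    refine h1.trans ?_
    rw [Fintype.card_piFinset, Finset.card_insert_of_notMem (notMem_epochRounds_self ht)]
    have h2 : (t : ℝ) ≤ 4 * ((epochRounds (epoch t - 1)).card + 1 : ℕ) := by
      exact_mod_cast le_four_mul_card_epochRounds ht
    have h3 : ((∏ _i : Fin d, (Finset.range (cellsPerAxis h)).card : ℕ) : ℝ) = numCells d h := by
      simp [numCells]
    rw [h3, hlam_def, div_le_div_iff₀ (by positivity) ht0]
    nlinarith
  have hcast : ∀ ω, ((cellSample h (fun s => x s ω) t).card + 1 : ℝ) ^ (-a)
      ≤ lam ^ a + lam ^ (a - 1) * ((cellSample h (fun s => x s ω) t).card + 1 : ℝ)⁻¹ := by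
    intro ω
    rw [Real.rpow_neg (by positivity), ← Real.inv_rpow (by positivity)]
    exact rpow_le_add_mul (by positivity) hlam ha0 ha1
  have hi1 : Integrable (fun ω => ((cellSample h (fun s => x s ω) t).card + 1 : ℝ)⁻¹) P := by
    simpa only [Real.rpow_neg_one] using hx.integrable_card_rpow h t zero_le_one
  calc ∫ ω, ((cellSample h (fun s => x s ω) t).card + 1 : ℝ) ^ (-a) ∂P
      ≤ ∫ ω, (lam ^ a + lam ^ (a - 1) * ((cellSample h (fun s => x s ω) t).card + 1 : ℝ)⁻¹) ∂P :=
        integral_mono (hx.integrable_card_rpow h t ha0)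
          ((integrable_const _).add (hi1.const_mul _)) hcast
    _ = lam ^ a + lam ^ (a - 1) * ∫ ω, ((cellSample h (fun s => x s ω) t).card + 1 : ℝ)⁻¹ ∂P := by
        rw [integral_add (integrable_const _) (hi1.const_mul _), integral_const_mul]
        simp
    _ ≤ lam ^ a + lam ^ (a - 1) * lam := by gcongr
    _ = 2 * lam ^ a := by
        rw [← Real.rpow_add_one hlam.ne', sub_add_cancel]
        ring

end Counting

/-! ### The regret of one round for random contexts -/

section RandomDesign

lemma HolderOnCube.continuousOn {d : ℕ} {β H : ℝ} {m : Ctx d → ℝ} (hm : HolderOnCube β H m)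
    (hβ : 0 < β) : ContinuousOn m (unitCube d) := by
  intro z hz
  rw [ContinuousWithinAt, tendsto_iff_dist_tendsto_zero]
  have hlim : Tendsto (fun z' : Ctx d => H * ‖z' - z‖ ^ β) (𝓝[unitCube d] z) (𝓝 0) := by
    have hc : Continuous fun z' : Ctx d => H * ‖z' - z‖ ^ β :=
      continuous_const.mul ((continuous_id.sub continuous_const).norm.rpow_const
        fun _ => Or.inr hβ.le)
    have := hc.tendsto z
    simp only [sub_self, norm_zero, Real.zero_rpow hβ.ne', mul_zero] at this
    exact this.mono_left nhdsWithin_le_nhds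
  refine squeeze_zero' (Eventually.of_forall fun _ => dist_nonneg) ?_ hlim
  filter_upwards [self_mem_nhdsWithin] with z' hz'
  rw [Real.dist_eq]
  exact hm z' hz' z hz

lemma measurableSet_unitCube (d : ℕ) : MeasurableSet (unitCube d) := by
  have : unitCube d = ⋂ i, {z : Ctx d | 0 ≤ z i} ∩ {z : Ctx d | z i ≤ 1} := by
    ext z
    simp [unitCube]
  rw [this]
  exact MeasurableSet.iInter fun i => (measurableSet_le measurable_const (by fun_prop)).inter
    (measurableSet_le (by fun_prop) measurable_const)

variable {Ω : Type*} {d : ℕ} {β H B L p σ μ₀ π₀ : ℝ} {T t : ℕ} {m : Ctx d → ℝ}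
  {x : ℕ → Ω → Ctx d} {ξ ζ : ℕ → Ω → ℝ}

lemma roundRegret_congr {m' : Ctx d → ℝ} (h : ∀ s ω, m (x s ω) = m' (x s ω)) :
    roundRegret β B p σ π₀ T m x ξ ζ t = roundRegret β B p σ π₀ T m' x ξ ζ t := by
  funext ω
  simp only [roundRegret, valuation, h]

/-- The price as an expression in which the random index set `cellSample` enters only through
indicators and its cardinality, so that measurability can be read off. -/
lemma price_eq_ite (z : ℕ → Ctx d) (v w : ℕ → ℝ) :
    price β B p σ π₀ T z v w t =
      if epoch t ≤ 1 ∨ ((cellSample (sideLength d β p T) z t).card : ℝ) = 0 then π₀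
      else (∑ s ∈ epochRounds (epoch t - 1),
          if cellIndex (sideLength d β p T) (z s) = cellIndex (sideLength d β p T) (z t)
          then trunc (((B + σ) ^ p * ((cellSample (sideLength d β p T) z t).card : ℝ)
              / Real.log ((numCells d (sideLength d β p T) : ℝ) * (T : ℝ))) ^ (1 / p))
              ((v s + w s) / 2)
          else 0) / ((cellSample (sideLength d β p T) z t).card : ℝ) := by
  rw [← Finset.sum_filter]
  simp only [price, Nat.cast_eq_zero, Finset.card_eq_zero]
  rfl

variable [MeasurableSpace Ω]

lemma measurable_price (hx : ∀ s, Measurable (x s)) {v w : ℕ → Ω → ℝ} (hv : ∀ s, Measurable (v s))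
    (hw : ∀ s, Measurable (w s)) :
    Measurable fun ω =>
      price β B p σ π₀ T (fun s => x s ω) (fun s => v s ω) (fun s => w s ω) t := by
  simp_rw [price_eq_ite]
  have hn := measurable_cellSample_card (sideLength d β p T) hx t
  refine Measurable.ite ?_ measurable_const (Measurable.div ?_ hn)
  · exact (MeasurableSet.const _).union (measurableSet_eq_fun hn measurable_const)
  · refine Finset.measurable_sum _ fun s _ => Measurable.ite ?_ ?_ measurable_const
    · exact measurableSet_eq_fun ((measurable_cellIndex _).comp (hx s))
        ((measurable_cellIndex _).comp (hx t))
    · refine measurable_trunc.comp (Measurable.prodMk ?_ (((hv s).add (hw s)).div_const 2))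
      exact ((hn.const_mul _).div_const _).pow_const _

lemma measurable_roundRegret (hm : Measurable m) (hx : ∀ s, Measurable (x s))
    (hξ : ∀ s, Measurable (ξ s)) (hζ : ∀ s, Measurable (ζ s)) :
    Measurable (roundRegret β B p σ π₀ T m x ξ ζ t) := by
  have hV : ∀ s, Measurable (valuation m x ξ s) := fun s => (hm.comp (hx s)).add (hξ s)
  have hW : ∀ s, Measurable (valuation m x ζ s) := fun s => (hm.comp (hx s)).add (hζ s)
  unfold roundRegret
  exact (measurable_gain.comp ((hm.comp (hx t)).prodMk ((hV t).prodMk (hW t)))).sub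
    (measurable_gain.comp ((measurable_price hx hV hW).prodMk ((hV t).prodMk (hW t))))

variable {P : Measure Ω}

/-- The values of the market value function off the cube are irrelevant, so it may be assumed to be
measurable. -/
lemma IsEnvironment.exists_measurable (env : IsEnvironment P β H B L p σ μ₀ m x ξ ζ) (hβ : 0 < β) :
    ∃ m' : Ctx d → ℝ, Measurable m' ∧ IsEnvironment P β H B L p σ μ₀ m' x ξ ζ ∧
      ∀ s ω, m (x s ω) = m' (x s ω) := by
  classical
  set m' : Ctx d → ℝ := (unitCube d).piecewise m 0 with hm'
  have heq : ∀ z ∈ unitCube d, m' z = m z := fun z hz => Set.piecewise_eq_of_mem _ _ _ hz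
  refine ⟨m', (env.holder.continuousOn hβ).measurable_piecewise continuousOn_const
    (measurableSet_unitCube d), ⟨?_, ?_, env.contexts, env.noise_xi, env.noise_zeta,
    env.indep_rounds, env.indep_context_noise, env.indep_noise⟩, ?_⟩
  · intro z hz z' hz'
    rw [heq z hz, heq z' hz']
    exact env.holder z hz z' hz'
  · intro z hz
    rw [heq z hz]
    exact env.bounded z hz
  · exact fun s ω => (heq _ (env.contexts.mem_cube s ω)).symm

/-- The regret of a round is dominated by `|ξ t - ζ t|`. -/
lemma IsEnvironment.integrable_roundRegret (env : IsEnvironment P β H B L p σ μ₀ m x ξ ζ)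
    (hβ : 0 < β) : Integrable (roundRegret β B p σ π₀ T m x ξ ζ t) P := by
  obtain ⟨m', hm', -, heq⟩ := env.exists_measurable hβ
  refine (env.integrable_abs_sub t).mono' ?_ (ae_of_all _ fun ω => abs_roundRegret_le ω)
  rw [roundRegret_congr heq]
  exact (measurable_roundRegret hm' env.contexts.measurable (fun s => (env.noise_xi s).measurable)
    fun s => (env.noise_zeta s).measurable).aestronglyMeasurable

variable [IsProbabilityMeasure P]

/-- The expected regret of round `t`: the bound for fixed contexts, with the negative power of the
number of observations replaced by its expectation. -/
lemma IsEnvironment.integral_roundRegret_le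
    (env : IsEnvironment P β H B L p σ μ₀ m x ξ ζ) (hβ : 0 < β) (hH : 0 ≤ H) (hB : 0 ≤ B)
    (hL : 0 ≤ L) (hσ : 0 < σ) (hp1 : 1 < p) (hp2 : p ≤ 2) (hT : 2 ≤ T) (ht : 1 ≤ t) :
    ∫ ω, roundRegret β B p σ π₀ T m x ξ ζ t ω ∂P
      ≤ 4 * L * (H * (√d * sideLength d β p T) ^ β) ^ 2
        + 2 * errorCoeff L (B + σ) σ p
            (Real.log ((numCells d (sideLength d β p T) : ℝ) * (T : ℝ)))
          * (4 * numCells d (sideLength d β p T) / t) ^ (2 - 2 / p) := by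
  obtain ⟨m', hm', env', heq⟩ := env.exists_measurable hβ
  rw [roundRegret_congr heq]
  have hp0 : 0 < p := by linarith
  have h2p1 : 1 ≤ 2 / p := by rw [le_div_iff₀ hp0]; linarith
  have h2p2 : 2 / p ≤ 2 := by rw [div_le_iff₀ hp0]; linarith
  have ha0 : 0 ≤ 2 - 2 / p := by linarith
  have ha1 : 2 - 2 / p ≤ 1 := by linarith
  set h := sideLength d β p T with hh_def
  have hh : 0 < h := sideLength_pos hT
  set l := Real.log ((numCells d h : ℝ) * (T : ℝ)) with hl_def
  have hl : 1 / 2 ≤ l := half_le_log_numCells_mul hh hT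
  have hl0 : 0 < l := by linarith
  have hcoeff : 0 ≤ errorCoeff L (B + σ) σ p l := by
    unfold errorCoeff
    positivity
  set D := 4 * L * (H * (√d * h) ^ β) ^ 2
  have hx : iIndepFun x P := env.indep_rounds.comp (fun _ => Prod.fst) fun _ => measurable_fst
  have hci := env.contexts.integrable_card_rpow h t ha0
  have hXY : IndepFun (fun ω s => x s ω) (fun ω s => (ξ s ω, ζ s ω)) P :=
    indepFun_process_of_iIndepFun_prodMk env.contexts.measurable env.measurable_noise
      env.indep_rounds env.indep_context_noise
  have hf : Measurable (Function.uncurry fun (z : ℕ → Ctx d) (y : ℕ → ℝ × ℝ) =>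
      roundRegret β B p σ π₀ T m' (fun s _ => z s) (fun s (q : ℕ → ℝ × ℝ) => (q s).1)
        (fun s q => (q s).2) t y) :=
    measurable_roundRegret (Ω := (ℕ → Ctx d) × (ℕ → ℝ × ℝ)) (x := fun s q => q.1 s)
      (ξ := fun s q => (q.2 s).1) (ζ := fun s q => (q.2 s).2) hm' (fun s => by fun_prop)
      (fun s => by fun_prop) fun s => by fun_prop
  have hfub := integral_le_of_indepFun (P := P) (X := fun ω s => x s ω)
    (Y := fun ω s => (ξ s ω, ζ s ω)) (measurable_pi_iff.2 env.contexts.measurable)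
    (measurable_pi_iff.2 env.measurable_noise) hXY hf (env'.integrable_roundRegret hβ)
    (b := fun z => D + errorCoeff L (B + σ) σ p l
      * ((cellSample h z t).card + 1 : ℝ) ^ (-(2 - 2 / p)))
    ((integrable_const _).add (hci.const_mul _))
    fun ω' => env'.integral_roundRegret_const_le hβ hH hB hL hσ hp1 hp2 hT ht
      (z := fun s => x s ω') fun s => env.contexts.mem_cube s ω'
  refine le_trans hfub ?_
  clear_value D
  rw [integral_add (integrable_const _) (hci.const_mul _), integral_const_mul, integral_const,
    probReal_univ, one_smul]
  have hcount := env.contexts.integral_card_rpow_le hx hh ht ha0 ha1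
  calc D + errorCoeff L (B + σ) σ p l
        * ∫ ω, ((cellSample h (fun s => x s ω) t).card + 1 : ℝ) ^ (-(2 - 2 / p)) ∂P
      ≤ D + errorCoeff L (B + σ) σ p l * (2 * (4 * numCells d h / t) ^ (2 - 2 / p)) := by gcongr
    _ = D + 2 * errorCoeff L (B + σ) σ p l * (4 * numCells d h / t) ^ (2 - 2 / p) := by ring

end RandomDesign

/-! ### Summation over the rounds -/

section Rates

variable {d : ℕ} {β p : ℝ} {T : ℕ}

lemma half_le_log (hT : 2 ≤ T) : 1 / 2 ≤ Real.log T := by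
  have h2 : (2 : ℝ) ≤ T := by exact_mod_cast hT
  calc (1 : ℝ) / 2 ≤ Real.log 2 := by linarith [Real.log_two_gt_d9]
    _ ≤ Real.log T := Real.log_le_log two_pos h2

lemma sideLength_le_one (hβ : 0 < β) (hp : 1 < p) (hT : 2 ≤ T) : sideLength d β p T ≤ 1 := by
  have hT1 : (1 : ℝ) ≤ T := by exact_mod_cast (by omega : 1 ≤ T)
  have hp1 : 0 < p - 1 := by linarith
  have hD : 0 < β * p + d * (p - 1) := by positivity
  exact Real.rpow_le_one_of_one_le_of_nonpos hT1 (neg_nonpos.2 (by positivity))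

lemma numCells_le {h : ℝ} (hh : 0 < h) (hh1 : h ≤ 1) : (numCells d h : ℝ) ≤ (2 * h⁻¹) ^ d := by
  unfold numCells cellsPerAxis
  rw [Nat.cast_pow]
  have h1 : 1 ≤ h⁻¹ := (one_le_inv₀ hh).2 hh1
  gcongr
  linarith [(Nat.ceil_lt_add_one (inv_pos.2 hh).le).le]

lemma sideLength_inv :
    (sideLength d β p T)⁻¹ = (T : ℝ) ^ ((p - 1) / (β * p + d * (p - 1))) := by
  unfold sideLength
  rw [← Real.rpow_neg (Nat.cast_nonneg T), neg_neg]

lemma log_numCells_mul_le (hβ : 0 < β) (hp : 1 < p) (hT : 2 ≤ T) :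
    Real.log ((numCells d (sideLength d β p T) : ℝ) * T) ≤ (d + 2) * Real.log T := by
  set h := sideLength d β p T with hh_def
  have hh : 0 < h := sideLength_pos hT
  have hT2 : (2 : ℝ) ≤ T := by exact_mod_cast hT
  have hT0 : (0 : ℝ) < T := by linarith
  have hp1 : 0 < p - 1 := by linarith
  have hD : 0 < β * p + d * (p - 1) := by positivity
  have hM0 : (0 : ℝ) < numCells d h := by exact_mod_cast one_le_numCells d hh
  have hlog : Real.log 2 ≤ Real.log T := Real.log_le_log two_pos hT2
  have hlogT : 0 ≤ Real.log T := by linarith [half_le_log hT]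
  have e1 : Real.log (numCells d h) ≤ d * (Real.log 2
      + (p - 1) / (β * p + d * (p - 1)) * Real.log T) := by
    refine (Real.log_le_log hM0 (numCells_le hh (sideLength_le_one hβ hp hT))).trans_eq ?_
    rw [Real.log_pow, Real.log_mul two_ne_zero (inv_pos.2 hh).ne', hh_def, sideLength_inv,
      Real.log_rpow hT0]
  have e2 : d * ((p - 1) / (β * p + d * (p - 1))) ≤ 1 := by
    rw [← mul_div_assoc, div_le_one hD]
    have : 0 < β * p := by positivity
    linarith
  rw [Real.log_mul hM0.ne' hT0.ne']
  have e3 : d * Real.log 2 ≤ d * Real.log T := by gcongr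
  have e4 : d * ((p - 1) / (β * p + d * (p - 1))) * Real.log T ≤ 1 * Real.log T := by gcongr
  linarith

lemma sum_rpow_neg_le {a : ℝ} (ha1 : a ≤ 1) (hT : 2 ≤ T) :
    ∑ t ∈ Finset.Icc 1 T, (t : ℝ) ^ (-a) ≤ (T : ℝ) ^ (1 - a) * (3 * Real.log T) := by
  have hT0 : (0 : ℝ) ≤ (T : ℝ) ^ (1 - a) := by positivity
  calc ∑ t ∈ Finset.Icc 1 T, (t : ℝ) ^ (-a)
      ≤ ∑ t ∈ Finset.Icc 1 T, (T : ℝ) ^ (1 - a) * (t : ℝ)⁻¹ := by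
        -- As `a ≤ 1`, `t ^ (-a) = t ^ (1 - a) / t ≤ T ^ (1 - a) / t`: the sum is a harmonic one.
        refine Finset.sum_le_sum fun t ht => ?_
        obtain ⟨h1, h2⟩ := Finset.mem_Icc.1 ht
        have ht0 : (0 : ℝ) < t := by exact_mod_cast h1
        have h3 : (t : ℝ) ^ (-a) = (t : ℝ) ^ (1 - a) * (t : ℝ)⁻¹ := by
          rw [← Real.rpow_neg_one, ← Real.rpow_add ht0]
          congr 1
          ring
        rw [h3]
        have h4 : (t : ℝ) ≤ T := by exact_mod_cast h2
        gcongr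
    _ = (T : ℝ) ^ (1 - a) * ((harmonic T : ℚ) : ℝ) := by
        rw [← Finset.mul_sum, harmonic_eq_sum_Icc]
        push_cast
        rfl
    _ ≤ (T : ℝ) ^ (1 - a) * (3 * Real.log T) := by
        gcongr
        linarith [harmonic_le_one_add_log T, half_le_log hT]

/-- The total approximation error `T h ^ (2 β)` has the rate of the theorem. -/
lemma mul_sideLength_rpow (hβ : 0 < β) (hp : 1 < p) (hT : 2 ≤ T) :
    (T : ℝ) * (sideLength d β p T ^ β) ^ 2 = (T : ℝ) ^ rateExponent d β p := by
  have hT0 : (0 : ℝ) < T := by exact_mod_cast (by omega : 0 < T)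
  have hp1 : 0 < p - 1 := by linarith
  have hD : 0 < β * p + d * (p - 1) := by positivity
  unfold sideLength rateExponent
  rw [← Real.rpow_mul hT0.le, ← Real.rpow_mul_natCast hT0.le, mul_comm, ← Real.rpow_add_one hT0.ne']
  congr 1
  push_cast
  ring

/-- The total statistical error `T ^ (1 - a) h ^ (-d a)`, with `a = 2 - 2 / p`, has the rate of the
theorem. -/
lemma rpow_mul_sideLength_inv (hβ : 0 < β) (hp : 1 < p) (hT : 2 ≤ T) :
    (T : ℝ) ^ (1 - (2 - 2 / p)) * (((sideLength d β p T)⁻¹) ^ d) ^ (2 - 2 / p)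
      = (T : ℝ) ^ rateExponent d β p := by
  have hT0 : (0 : ℝ) < T := by exact_mod_cast (by omega : 0 < T)
  have hp1 : 0 < p - 1 := by linarith
  have hp0 : p ≠ 0 := by linarith
  have hD : β * p + d * (p - 1) ≠ 0 := by positivity
  rw [sideLength_inv, ← Real.rpow_mul_natCast hT0.le, ← Real.rpow_mul hT0.le,
    ← Real.rpow_add hT0]
  congr 1
  unfold rateExponent
  field_simp
  ring

lemma rateExponent_two (hβ : 0 < β) : rateExponent d β 2 = d / (2 * β + d) := by
  have h1 : β * 2 + d * (2 - 1) ≠ 0 := by positivity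
  have h2 : 2 * β + d ≠ 0 := by positivity
  unfold rateExponent
  field_simp
  ring

lemma tendsto_rateExponent (d : ℕ) (hβ : 0 < β) :
    Tendsto (fun p : ℝ => rateExponent d β p) (𝓝[>] 1) (𝓝 1) := by
  have h : ContinuousAt (fun p : ℝ => rateExponent d β p) 1 := by
    unfold rateExponent
    refine continuousAt_const.sub (ContinuousAt.div (by fun_prop) (by fun_prop) ?_)
    simpa using hβ.ne'
  have h1 := h.tendsto
  simp only [rateExponent, sub_self, mul_zero, zero_div, sub_zero] at h1
  exact h1.mono_left nhdsWithin_le_nhds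

lemma errorCoeff_le {L b σ l lam A : ℝ} (hL : 0 ≤ L) (hσ : 0 ≤ σ) (hlam : 1 / 2 ≤ lam)
    (hA : 0 ≤ A) (hl0 : 0 ≤ l) (hl : l ≤ A * lam) :
    errorCoeff L b σ p l
      ≤ (4 * (2 + 2 * σ ^ p) + 16 * L * b ^ 2 * (54 * A + 2 * 27 ^ 2 * A ^ 2)) * lam ^ 2 := by
  have h1 : 1 ≤ 4 * lam ^ 2 := by nlinarith
  have h2 : lam ≤ 2 * lam ^ 2 := by nlinarith
  have h3 : 0 ≤ σ ^ p := by positivity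
  have h4 : l ^ 2 ≤ (A * lam) ^ 2 := by gcongr
  have h5 : l ≤ A * (2 * lam ^ 2) := hl.trans (by gcongr)
  have h6 : 27 * l + 2 * 27 ^ 2 * l ^ 2 ≤ (54 * A + 2 * 27 ^ 2 * A ^ 2) * lam ^ 2 := by nlinarith
  calc errorCoeff L b σ p l
      ≤ (2 + 2 * σ ^ p) * (4 * lam ^ 2)
        + 16 * L * b ^ 2 * ((54 * A + 2 * 27 ^ 2 * A ^ 2) * lam ^ 2) := by
        unfold errorCoeff
        gcongr
        exact le_mul_of_one_le_right (by positivity) h1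
    _ = _ := by ring

end Rates

/-- The constant in the regret bound; it does not depend on the horizon or the environment. -/
def regretConst (d : ℕ) (β H B L p σ : ℝ) : ℝ :=
  32 * L * (H * √d ^ β) ^ 2
    + 6 * (4 * 2 ^ d)
      * (4 * (2 + 2 * σ ^ p) + 16 * L * (B + σ) ^ 2 * (54 * (d + 2) + 2 * 27 ^ 2 * (d + 2) ^ 2))

section Regret

variable {d : ℕ} {β H B L p σ μ₀ π₀ : ℝ} {T : ℕ} {m : Ctx d → ℝ} {Ω : Type*}
  {x : ℕ → Ω → Ctx d} {ξ ζ : ℕ → Ω → ℝ} [MeasurableSpace Ω] {P : Measure Ω}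
  [IsProbabilityMeasure P]

lemma IsEnvironment.regret_le
    (env : IsEnvironment P β H B L p σ μ₀ m x ξ ζ) (hβ : 0 < β) (hH : 0 ≤ H) (hB : 0 ≤ B)
    (hL : 0 ≤ L) (hσ : 0 < σ) (hp1 : 1 < p) (hp2 : p ≤ 2) (hT : 2 ≤ T) :
    regret P β B p σ π₀ T m x ξ ζ
      ≤ regretConst d β H B L p σ * Real.log T ^ 3 * (T : ℝ) ^ rateExponent d β p := by
  have hp0 : 0 < p := by linarith
  have h2p1 : 1 ≤ 2 / p := by rw [le_div_iff₀ hp0]; linarith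
  have h2p2 : 2 / p ≤ 2 := by rw [div_le_iff₀ hp0]; linarith
  set h := sideLength d β p T with hh_def
  have hh : 0 < h := sideLength_pos hT
  have hlaw := mul_sideLength_rpow (d := d) hβ hp1 hT
  have hlaw' := rpow_mul_sideLength_inv (d := d) hβ hp1 hT
  rw [← hh_def] at hlaw hlaw'
  set a := 2 - 2 / p with ha_def
  have ha0 : 0 ≤ a := by linarith
  have ha1 : a ≤ 1 := by linarith
  set l := Real.log ((numCells d h : ℝ) * (T : ℝ)) with hl_def
  have hl0 : 0 ≤ l := by linarith [half_le_log_numCells_mul (d := d) hh hT]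
  set lam := Real.log T with hlam_def
  have hlam : 1 / 2 ≤ lam := half_le_log hT
  set R := (T : ℝ) ^ rateExponent d β p with hR
  have hR0 : 0 ≤ R := by positivity
  set c₁ := 4 * (2 + 2 * σ ^ p) + 16 * L * (B + σ) ^ 2 * (54 * (d + 2) + 2 * 27 ^ 2 * (d + 2) ^ 2)
    with hc₁
  have hc₁0 : 0 ≤ c₁ := by positivity
  have hE : errorCoeff L (B + σ) σ p l ≤ c₁ * lam ^ 2 :=
    errorCoeff_le hL hσ.le hlam (by positivity) hl0 (log_numCells_mul_le hβ hp1 hT)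
  have hM : (4 * numCells d h : ℝ) ^ a ≤ 4 * 2 ^ d * ((h⁻¹) ^ d) ^ a := by
    have h1 : (4 * numCells d h : ℝ) ≤ (4 * 2 ^ d) * (h⁻¹) ^ d := by
      have := numCells_le (d := d) hh (sideLength_le_one hβ hp1 hT)
      rw [mul_pow] at this
      linarith
    have h2 : (1 : ℝ) ≤ 4 * 2 ^ d := by
      have : (1 : ℝ) ≤ 2 ^ d := one_le_pow₀ one_le_two
      linarith
    calc (4 * numCells d h : ℝ) ^ a ≤ ((4 * 2 ^ d) * (h⁻¹) ^ d) ^ a := by gcongr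
      _ = (4 * 2 ^ d) ^ a * ((h⁻¹) ^ d) ^ a := Real.mul_rpow (by positivity) (by positivity)
      _ ≤ 4 * 2 ^ d * ((h⁻¹) ^ d) ^ a := by
          gcongr
          exact Real.rpow_le_self_of_one_le h2 ha1
  have happ : (T : ℝ) * (4 * L * (H * (√d * h) ^ β) ^ 2) = 4 * L * (H * √d ^ β) ^ 2 * R := by
    rw [Real.mul_rpow (by positivity) hh.le, ← hlaw]
    ring
  have hround : ∀ t ∈ Finset.Icc 1 T, ∫ ω, roundRegret β B p σ π₀ T m x ξ ζ t ω ∂P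
      ≤ 4 * L * (H * (√d * h) ^ β) ^ 2
        + 2 * (c₁ * lam ^ 2) * (4 * 2 ^ d * ((h⁻¹) ^ d) ^ a) * (t : ℝ) ^ (-a) := by
    intro t ht
    refine (env.integral_roundRegret_le hβ hH hB hL hσ hp1 hp2 hT (Finset.mem_Icc.1 ht).1).trans ?_
    rw [← hh_def, ← hl_def, ← ha_def, Real.div_rpow (by positivity) (by positivity), div_eq_mul_inv,
      ← Real.rpow_neg (Nat.cast_nonneg t), ← mul_assoc (2 * _)]
    gcongr
  have hsum := sum_rpow_neg_le ha1 hT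
  -- The approximation error carries no logarithm; `1 ≤ 8 (log T) ^ 3` supplies one.
  have hlam3 : 1 ≤ 4 * lam ^ 3 * 2 := by
    have : (1 / 2 : ℝ) ^ 3 ≤ lam ^ 3 := by gcongr
    linarith
  calc regret P β B p σ π₀ T m x ξ ζ
      ≤ ∑ t ∈ Finset.Icc 1 T, (4 * L * (H * (√d * h) ^ β) ^ 2
        + 2 * (c₁ * lam ^ 2) * (4 * 2 ^ d * ((h⁻¹) ^ d) ^ a) * (t : ℝ) ^ (-a)) :=
        Finset.sum_le_sum hround
    _ = 4 * L * (H * √d ^ β) ^ 2 * R + 2 * (c₁ * lam ^ 2) * (4 * 2 ^ d * ((h⁻¹) ^ d) ^ a)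
          * ∑ t ∈ Finset.Icc 1 T, (t : ℝ) ^ (-a) := by
        rw [Finset.sum_add_distrib, Finset.sum_const, Nat.card_Icc, Nat.add_sub_cancel,
          nsmul_eq_mul, happ, ← Finset.mul_sum]
    _ ≤ 4 * L * (H * √d ^ β) ^ 2 * R + 2 * (c₁ * lam ^ 2) * (4 * 2 ^ d * ((h⁻¹) ^ d) ^ a)
          * ((T : ℝ) ^ (1 - a) * (3 * lam)) := by gcongr
    _ = 4 * L * (H * √d ^ β) ^ 2 * R * 1 + 6 * (4 * 2 ^ d) * c₁ * lam ^ 3 * R := by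
        rw [← hlaw']
        ring
    _ ≤ 4 * L * (H * √d ^ β) ^ 2 * R * (4 * lam ^ 3 * 2) + 6 * (4 * 2 ^ d) * c₁ * lam ^ 3 * R := by
        gcongr
    _ = regretConst d β H B L p σ * lam ^ 3 * R := by
        rw [hc₁, regretConst]
        ring

end Regret

end

end BilateralTrade

theorem theorem2 (d : ℕ) (hd : 0 < d) (β H B L σ μ₀ : ℝ) (hβ : 0 < β) (hH : 0 ≤ H) (hB : 0 ≤ B)
    (hL : 1 ≤ L) (hσ : 0 < σ) (hμ₀ : 0 < μ₀) :
    (∀ p : ℝ, 1 < p → p ≤ 2 →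
      ∃ (C : ℝ) (κ : ℕ), 0 < C ∧
        ∀ (T : ℕ), 2 ≤ T → ∀ (π₀ : ℝ)
          (Ω : Type*) [MeasurableSpace Ω] (P : Measure Ω) [IsProbabilityMeasure P]
          (m : BilateralTrade.Ctx d → ℝ) (x : ℕ → Ω → BilateralTrade.Ctx d) (ξ ζ : ℕ → Ω → ℝ),
          BilateralTrade.IsEnvironment P β H B L p σ μ₀ m x ξ ζ →
            (∀ t ∈ Finset.Icc 1 T,
              Integrable (BilateralTrade.roundRegret β B p σ π₀ T m x ξ ζ t) P) ∧
            BilateralTrade.regret P β B p σ π₀ T m x ξ ζ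
              ≤ C * Real.log T ^ κ * (T : ℝ) ^ BilateralTrade.rateExponent d β p) ∧
    BilateralTrade.rateExponent d β 2 = d / (2 * β + d) ∧
    Tendsto (fun p : ℝ => BilateralTrade.rateExponent d β p) (𝓝[>] 1) (𝓝 1) := by
  have hL0 : 0 ≤ L := zero_le_one.trans hL
  refine ⟨fun p hp1 hp2 => ⟨BilateralTrade.regretConst d β H B L p σ, 3, ?_, ?_⟩,
    BilateralTrade.rateExponent_two hβ, BilateralTrade.tendsto_rateExponent d hβ⟩
  · unfold BilateralTrade.regretConst
    positivity
  · intro T hT π₀ Ω _ P _ m x ξ ζ env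
    exact ⟨fun t _ => env.integrable_roundRegret hβ,
      env.regret_le hβ hH hB hL0 hσ hp1 hp2 hT⟩
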